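/- **Model.** Let $\mu$ be a probability measure on $\mathbb R$ symmetric about $0$, let $h\sim\mu$, and let $\theta>0$. For a field $\mathbf h=(h_1,\dots,h_n)$ with i.i.d. coordinates of law $\mu$ and $S\subset[n]$ with $|S|=k$, let, for $\sigma\in\{-1,1\}^n$, $$\mathbb P_0(\sigma\mid\mathbf h)\propto\exp\Big(\sum_{i=1}^n h_i\sigma_i\Big),\qquad \mathbb P_S(\sigma\mid\mathbf h)\propto\exp\Big(\frac{\theta}{2k}\Big(\sum_{i\in S}\sigma_i\Big)^2+\sum_{i=1}^n h_i\sigma_i\Big),$$ each normalized to a probability on $\{-1,1\}^n$, and let $\mathbb P_0(\sigma)=\mathbb E_{\mathbf h}\,\mathbb P_0(\sigma\mid\mathbf h)$, $\mathbb P_S(\sigma)=\mathbb E_{\mathbf h}\,\mathbb P_S(\sigma\mid\mathbf h)$. One observes $m$ i.i.d. configurations (each with its own unobserved field), drawn from $\mathbb P_0$ under $H_0$ and from $\mathbb P_S$ for some unknown $S$ with $|S|=k$ under $H_1$. A test $\varphi$ maps the sample to a rejection probability in $[0,1]$; its risk is $\mathbb E_{0}^{\otimes m}[\varphi]+\max_{|S|=k}\mathbb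 E_{S}^{\otimes m}[1-\varphi]$. For sequences $k=k_n$ and $m=m_n$, all tests are *asymptotically powerless* if every sequence of tests $\varphi_n$ has $\liminf_{n\to\infty}\mathrm{risk}(\varphi_n)\ge1$. **High temperature.** Assume $0<\theta<1/\mathbb E[\operatorname{sech}^2h]$ and that $x=0$ is the unique global minimizer over $\mathbb R$ of $x\mapsto \frac{x^2}{2}-\mathbb E\big[\log\cosh(\sqrt\theta x+h)-\log\cosh h\big]$. **Theorem.** Let $\mu$ and $\theta$ be fixed, and let $2\le k_n\le n$ for all large $n$. 1. Suppose $k=o(n^{2/3})$. (a) If $\theta<\frac{1}{2\mathbb E[\operatorname{sech}^2h]}$, all tests are asymptotically powerless whenever $m=o(k\log n)$ and $m=o(n^2/k^2)$. (The second condition follows from the first when $k=O(n^{2/3}(\log n)^{-1/3})$.) (b) If $\theta\in\big[\frac{1}{2\mathbb E[\operatorname{sech}^2h]},\frac{1}{\mathbb E[\operatorname{sech}^2h]}\big)$, all tests are asymptotically powerless whenever $m=o\big(\frac{k}{\log k}\log n\big)$. 2. If $k=\Omega(n^{2/3})$, all tests are asymptotically powerless whenever $m=o(n^2/k^2)$.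 -/

import Mathlib

open MeasureTheory Filter Asymptotics

namespace PlantedRFCW

/-- A configuration of `n` spins, each equal to `1` or `-1`. -/
abbrev Config (n : ℕ) : Type := Fin n → ℤˣ

/-- The real value `1` or `-1` of a spin. -/
def spin (s : ℤˣ) : ℝ := ((s : ℤ) : ℝ)

/-- The Gibbs probability of `σ` for the (negative) energy function `H`. -/
noncomputable def gibbs {n : ℕ} (H : Config n → ℝ) (σ : Config n) : ℝ :=
  Real.exp (H σ) / ∑ τ : Config n, Real.exp (H τ)

/-- Exponent of the null model in the outer field `h`: no interaction between the spins. -/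
noncomputable def nullEnergy {n : ℕ} (h : Fin n → ℝ) (σ : Config n) : ℝ :=
  ∑ i, h i * spin (σ i)

/-- Exponent of the planted model in the outer field `h`: a Curie--Weiss interaction of strength
`θ` on the hidden clique `S`. -/
noncomputable def plantedEnergy {n : ℕ} (θ : ℝ) (S : Finset (Fin n)) (h : Fin n → ℝ)
    (σ : Config n) : ℝ :=
  θ / (2 * (S.card : ℝ)) * (∑ i ∈ S, spin (σ i)) ^ 2 + ∑ i, h i * spin (σ i)

/-- The law of one observed configuration under the null hypothesis: the field has i.i.d.
coordinates with law `μ` and is not observed. -/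
noncomputable def nullProb (μ : Measure ℝ) {n : ℕ} (σ : Config n) : ℝ :=
  ∫ h : Fin n → ℝ, gibbs (nullEnergy h) σ ∂(Measure.pi fun _ => μ)

/-- The law of one observed configuration when the clique is `S`: the field has i.i.d.
coordinates with law `μ` and is not observed. -/
noncomputable def plantedProb (μ : Measure ℝ) (θ : ℝ) {n : ℕ} (S : Finset (Fin n))
    (σ : Config n) : ℝ :=
  ∫ h : Fin n → ℝ, gibbs (plantedEnergy θ S h) σ ∂(Measure.pi fun _ => μ)

/-- A (possibly randomized) test based on `m` configurations of `n` spins: the probability of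
rejecting the null hypothesis, as a function of the sample. -/
abbrev Test (n m : ℕ) : Type := (Fin m → Config n) → unitInterval

/-- Probability that `φ` rejects when the sample consists of `m` independent configurations,
each drawn from the null model (with its own independent field). -/
noncomputable def typeIError (μ : Measure ℝ) {n m : ℕ} (φ : Test n m) : ℝ :=
  ∑ x : Fin m → Config n, (∏ j, nullProb μ (x j)) * (φ x : ℝ)

/-- Probability that `φ` accepts when the sample consists of `m` independent configurations,
each drawn from the model with clique `S` (with its own independent field). -/
noncomputable def typeIIError (μ : Measure ℝ) (θ : ℝ) {n m : ℕ} (S : Finset (Fin n))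
    (φ : Test n m) : ℝ :=
  ∑ x : Fin m → Config n, (∏ j, plantedProb μ θ S (x j)) * (1 - (φ x : ℝ))

/-- Worst-case risk: type I error plus the largest type II error over all cliques of size `k`. -/
noncomputable def risk (μ : Measure ℝ) (θ : ℝ) {n m : ℕ} (k : ℕ) (φ : Test n m) : ℝ :=
  typeIError μ φ + ⨆ S : {S : Finset (Fin n) // S.card = k}, typeIIError μ θ S.1 φ

/-- Every sequence of tests is asymptotically powerless: its worst-case risk has lower limit
at least `1`, the risk of a test that ignores the data. -/
def AllTestsPowerless (μ : Measure ℝ) (θ : ℝ) (k m : ℕ → ℕ) : Prop :=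
  ∀ φ : (n : ℕ) → Test n (m n), ∀ ε : ℝ, 0 < ε →
    ∀ᶠ n in atTop, 1 - ε ≤ risk μ θ (k n) (φ n)

/-- `E[sech² h]` for `h` with law `μ`. -/
noncomputable def meanSechSq (μ : Measure ℝ) : ℝ := ∫ h, (1 / Real.cosh h) ^ 2 ∂μ

/-- The mean-field potential `x² / 2 - E[log cosh (√θ x + h)]`, normalized to vanish at `0` by
adding `E[log cosh h]` under the expectation (so that it is finite for every law `μ`). -/
noncomputable def potential (μ : Measure ℝ) (θ x : ℝ) : ℝ :=
  x ^ 2 / 2 - ∫ h, (Real.log (Real.cosh (Real.sqrt θ * x + h)) - Real.log (Real.cosh h)) ∂μ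

/-- The high-temperature regime: `0 < θ < 1 / E[sech² h]`, and `0` is the unique global minimizer
of the mean-field potential. -/
def HighTemperature (μ : Measure ℝ) (θ : ℝ) : Prop :=
  0 < θ ∧ θ < 1 / meanSechSq μ ∧ ∀ x : ℝ, x ≠ 0 → potential μ θ 0 < potential μ θ x

end PlantedRFCW

namespace PlantedRFCW

/-! ### Spins and Gibbs measures -/

/-! The proof is a truncated second-moment argument for the mixture of the planted laws over a
uniform clique. Symmetry of `μ` makes the null law uniform (`nullProb_eq`), so the likelihood ratio
of one configuration is `2 ^ n * plantedProb μ θ S σ`. By `risk_ge_of_second_moment` it is enough to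
find minorants of the planted sample laws whose mixture has mass and normalized second moment close
to one. The second moment averages over pairs `S, S'` and is governed by the overlap `r = |S ∩ S'|`,
which is dominated by a Poisson variable of mean `k² / n`.

For `r ≤ ρ k` the pair correlation of one sample is at most `1 + C (r / k) ^ 2`
(`exists_overlap_bound`). In the Walsh basis only sets `A ⊆ S ∩ S'` contribute, singletons vanish by
the global spin flip, and coefficients depend on `|A|` alone. Since `r.choose a ≤ (r / k) ^ a *
k.choose a`, small overlap acts as noise, and hypercontractivity bounds the noisy `L²` norm by an
`L^p` norm with `p` near `1`. That norm is controlled by a Gaussian moment of the clique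
magnetization under the planted law.

This moment (`exists_exp_moment`) is where high temperature enters. For a fixed field,
Hubbard–Stratonovich linearizes the square. Unique minimality of the potential at `0`, the curvature
bound there, Hoeffding's inequality and compactness keep the resulting exponent below a parabola,
except on fields of exponentially small probability (`remControlled_univ`).

For `r > ρ k` the correlation may be exponentially large in the sample size. Restricting to samples
of typical total magnetization caps it by `exp (θ M m / 2)`, which the probability of such an
overlap, about `exp (-ρ k log (n / k))`, beats (`exists_overlap_sum_le`). All regimes of the theorem
then reduce to `SmallSample`. -/

lemma spin_one : spin 1 = 1 := by simp [spin]

lemma spin_neg (s : ℤˣ) : spin (-s) = -spin s := by simp [spin]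

lemma spin_mul (s t : ℤˣ) : spin (s * t) = spin s * spin t := by simp [spin]

lemma spin_eq_or (s : ℤˣ) : spin s = 1 ∨ spin s = -1 := by
  rcases Int.units_eq_one_or s with rfl | rfl
  · exact Or.inl spin_one
  · right; rw [spin_neg, spin_one]

lemma spin_mul_self (s : ℤˣ) : spin s * spin s = 1 := by
  rcases spin_eq_or s with h | h <;> rw [h] <;> norm_num

lemma abs_spin (s : ℤˣ) : |spin s| = 1 := by
  rcases spin_eq_or s with h | h <;> rw [h] <;> norm_num

lemma sum_units (f : ℤˣ → ℝ) : ∑ s : ℤˣ, f s = f 1 + f (-1) := by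
  rw [UnitsInt.univ]
  exact Finset.sum_pair (by decide)

lemma sum_config_prod {n : ℕ} (f : Fin n → ℤˣ → ℝ) :
    ∑ σ : Config n, ∏ i, f i (σ i) = ∏ i, (f i 1 + f i (-1)) := by
  simp_rw [← sum_units, Finset.prod_univ_sum, Fintype.piFinset_univ]

lemma card_config (n : ℕ) : Fintype.card (Config n) = 2 ^ n := by
  simp [Config]

section Gibbs

variable {n : ℕ} (H : Config n → ℝ) (σ : Config n)

lemma sum_exp_pos : 0 < ∑ τ : Config n, Real.exp (H τ) :=
  Finset.sum_pos (fun _ _ => Real.exp_pos _) Finset.univ_nonempty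

lemma gibbs_pos : 0 < gibbs H σ := div_pos (Real.exp_pos _) (sum_exp_pos H)

lemma sum_gibbs : ∑ σ : Config n, gibbs H σ = 1 := by
  unfold gibbs
  rw [← Finset.sum_div, div_self (sum_exp_pos H).ne']

lemma gibbs_le_one : gibbs H σ ≤ 1 := by
  rw [← sum_gibbs H]
  exact Finset.single_le_sum (fun τ _ => (gibbs_pos H τ).le) (Finset.mem_univ σ)

lemma gibbs_congr_equiv (H' : Config n → ℝ) (e : Config n ≃ Config n)
    (h : ∀ τ, H' (e τ) = H τ) : gibbs H' (e σ) = gibbs H σ := by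
  unfold gibbs
  rw [h, ← e.sum_comp]
  simp_rw [h]

lemma gibbs_add (G : Config n → ℝ) :
    gibbs (fun τ => G τ + H τ) σ =
      gibbs H σ * Real.exp (G σ) / ∑ τ, gibbs H τ * Real.exp (G τ) := by
  have hZ := (sum_exp_pos H).ne'
  have : ∑ τ, gibbs H τ * Real.exp (G τ) =
      (∑ τ, Real.exp (G τ + H τ)) / ∑ τ, Real.exp (H τ) := by
    rw [Finset.sum_div]
    refine Finset.sum_congr rfl fun τ _ => ?_
    rw [gibbs, Real.exp_add]; ring
  rw [this, gibbs, gibbs, Real.exp_add]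
  have := (sum_exp_pos (fun τ => G τ + H τ)).ne'
  field_simp

end Gibbs

/-- The magnetization of `σ` on the set `S`. -/
noncomputable def mag {n : ℕ} (S : Finset (Fin n)) (σ : Config n) : ℝ := ∑ i ∈ S, spin (σ i)

lemma mag_sq_le {n : ℕ} (S : Finset (Fin n)) (σ : Config n) :
    mag S σ ^ 2 ≤ (S.card : ℝ) ^ 2 := by
  rw [sq_le_sq, abs_of_nonneg (Nat.cast_nonneg (α := ℝ) S.card)]
  refine (Finset.abs_sum_le_sum_abs _ _).trans ?_
  simp [abs_spin]

lemma gibbs_nullEnergy {n : ℕ} (h : Fin n → ℝ) (σ : Config n) :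
    gibbs (nullEnergy h) σ = ∏ i, (Real.exp (h i * spin (σ i)) / (2 * Real.cosh (h i))) := by
  rw [gibbs, Finset.prod_div_distrib]
  unfold nullEnergy
  simp_rw [Real.exp_sum]
  rw [sum_config_prod (fun i s => Real.exp (h i * spin s))]
  congr 1
  refine Finset.prod_congr rfl fun i _ => ?_
  rw [spin_neg, spin_one, Real.cosh_eq]
  ring_nf

lemma gibbs_plantedEnergy {n : ℕ} (θ : ℝ) (S : Finset (Fin n)) (h : Fin n → ℝ) (σ : Config n) :
    gibbs (plantedEnergy θ S h) σ =
      gibbs (nullEnergy h) σ * Real.exp (θ / (2 * (S.card : ℝ)) * mag S σ ^ 2) /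
        ∑ τ, gibbs (nullEnergy h) τ * Real.exp (θ / (2 * (S.card : ℝ)) * mag S τ ^ 2) :=
  gibbs_add (nullEnergy h) σ (fun τ => θ / (2 * (S.card : ℝ)) * mag S τ ^ 2)

/-- The interaction has a nonnegative exponent, so it can only increase the partition function.
Upper bounds on the planted law may therefore drop the normalization. -/
lemma one_le_partition {n : ℕ} {θ : ℝ} (hθ : 0 ≤ θ) (S : Finset (Fin n)) (h : Fin n → ℝ) :
    1 ≤ ∑ τ, gibbs (nullEnergy h) τ * Real.exp (θ / (2 * (S.card : ℝ)) * mag S τ ^ 2) := by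
  rw [← sum_gibbs (nullEnergy h)]
  refine Finset.sum_le_sum fun τ _ => ?_
  refine le_mul_of_one_le_right (gibbs_pos _ _).le (Real.one_le_exp ?_)
  positivity

lemma gibbs_plantedEnergy_le {n : ℕ} {θ : ℝ} (hθ : 0 ≤ θ) (S : Finset (Fin n)) (h : Fin n → ℝ)
    (σ : Config n) : gibbs (plantedEnergy θ S h) σ ≤
      gibbs (nullEnergy h) σ * Real.exp (θ / (2 * (S.card : ℝ)) * mag S σ ^ 2) := by
  rw [gibbs_plantedEnergy]
  exact div_le_self (mul_nonneg (gibbs_pos _ _).le (Real.exp_pos _).le) (one_le_partition hθ S h)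

/-! ### Measurability and integrability in the field -/

lemma measurable_gibbs_nullEnergy {n : ℕ} (σ : Config n) :
    Measurable fun h : Fin n → ℝ => gibbs (nullEnergy h) σ := by
  unfold gibbs nullEnergy
  fun_prop

lemma measurable_gibbs_plantedEnergy {n : ℕ} (θ : ℝ) (S : Finset (Fin n)) (σ : Config n) :
    Measurable fun h : Fin n → ℝ => gibbs (plantedEnergy θ S h) σ := by
  unfold gibbs plantedEnergy
  fun_prop

lemma plantedProb_nonneg (μ : Measure ℝ) {n : ℕ} (θ : ℝ) (S : Finset (Fin n)) (σ : Config n) :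
    0 ≤ plantedProb μ θ S σ :=
  integral_nonneg fun _ => (gibbs_pos _ _).le

section Prob

variable (μ : Measure ℝ) [IsProbabilityMeasure μ] {n : ℕ}

lemma integrable_gibbs_nullEnergy (σ : Config n) :
    Integrable (fun h : Fin n → ℝ => gibbs (nullEnergy h) σ) (Measure.pi fun _ => μ) :=
  Integrable.of_bound (measurable_gibbs_nullEnergy σ).aestronglyMeasurable 1
    (ae_of_all _ fun h => by
      rw [Real.norm_of_nonneg (gibbs_pos _ _).le]; exact gibbs_le_one _ _)

lemma integrable_gibbs_plantedEnergy (θ : ℝ) (S : Finset (Fin n)) (σ : Config n) :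
    Integrable (fun h : Fin n → ℝ => gibbs (plantedEnergy θ S h) σ) (Measure.pi fun _ => μ) :=
  Integrable.of_bound (measurable_gibbs_plantedEnergy θ S σ).aestronglyMeasurable 1
    (ae_of_all _ fun h => by
      rw [Real.norm_of_nonneg (gibbs_pos _ _).le]; exact gibbs_le_one _ _)

lemma sum_plantedProb_mul (θ : ℝ) (S : Finset (Fin n)) (G : Config n → ℝ) :
    ∑ σ, plantedProb μ θ S σ * G σ =
      ∫ h : Fin n → ℝ, ∑ σ, gibbs (plantedEnergy θ S h) σ * G σ ∂(Measure.pi fun _ => μ) := by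
  rw [integral_finsetSum _ fun σ _ => (integrable_gibbs_plantedEnergy μ θ S σ).mul_const _]
  simp_rw [integral_mul_const]
  rfl

lemma sum_nullProb_mul (G : Config n → ℝ) :
    ∑ σ, nullProb μ σ * G σ =
      ∫ h : Fin n → ℝ, ∑ σ, gibbs (nullEnergy h) σ * G σ ∂(Measure.pi fun _ => μ) := by
  rw [integral_finsetSum _ fun σ _ => (integrable_gibbs_nullEnergy μ σ).mul_const _]
  simp_rw [integral_mul_const]
  rfl

lemma sum_plantedProb (θ : ℝ) (S : Finset (Fin n)) : ∑ σ, plantedProb μ θ S σ = 1 := by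
  have := sum_plantedProb_mul μ θ S (fun _ => 1)
  simpa [sum_gibbs] using this

lemma sum_nullProb : ∑ σ : Config n, nullProb μ σ = 1 := by
  have := sum_nullProb_mul μ (n := n) (fun _ => 1)
  simpa [sum_gibbs] using this

/-! ### Symmetries -/

variable {μ}

lemma measurePreserving_flip (hμ : μ.map (fun h : ℝ => -h) = μ) (ε : Config n) :
    MeasurePreserving (fun (h : Fin n → ℝ) i => spin (ε i) * h i)
      (Measure.pi fun _ => μ) (Measure.pi fun _ => μ) := by
  refine measurePreserving_pi (fun _ => μ) (fun _ => μ) (f := fun i x => spin (ε i) * x)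
    fun i => ?_
  rcases spin_eq_or (ε i) with h | h <;> simp only [h]
  · simp only [one_mul]; exact MeasurePreserving.id μ
  · simpa using (⟨measurable_neg, hμ⟩ : MeasurePreserving (fun h : ℝ => -h) μ μ)

lemma integral_flip (hμ : μ.map (fun h : ℝ => -h) = μ) (ε : Config n) (f : (Fin n → ℝ) → ℝ)
    (hf : Measurable f) :
    ∫ h, f (fun i => spin (ε i) * h i) ∂(Measure.pi fun _ => μ) =
      ∫ h, f h ∂(Measure.pi fun _ => μ) := by
  have h := measurePreserving_flip hμ ε
  conv_rhs => rw [← h.map_eq]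
  rw [integral_map h.measurable.aemeasurable hf.aestronglyMeasurable]

/-- Gauge invariance: flipping spins and fields at the same sites cancels. Symmetry of `μ` then
absorbs the flip of the field, so averaged laws inherit invariance under spin flips. -/
lemma nullEnergy_flip (ε : Config n) (h : Fin n → ℝ) (σ : Config n) :
    nullEnergy (fun i => spin (ε i) * h i) (ε * σ) = nullEnergy h σ := by
  unfold nullEnergy
  refine Finset.sum_congr rfl fun i _ => ?_
  rw [Pi.mul_apply, spin_mul]
  linear_combination h i * spin (σ i) * spin_mul_self (ε i)

lemma nullProb_mul_left (hμ : μ.map (fun h : ℝ => -h) = μ) (ε σ : Config n) :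
    nullProb μ (ε * σ) = nullProb μ σ := by
  unfold nullProb
  rw [← integral_flip hμ ε _ (measurable_gibbs_nullEnergy (ε * σ))]
  refine integral_congr_ae (ae_of_all _ fun h => ?_)
  exact gibbs_congr_equiv (nullEnergy h) σ _ (Equiv.mulLeft ε) (nullEnergy_flip ε h)

/-- Under the null model the observed configuration is uniform. -/
lemma nullProb_eq (hμ : μ.map (fun h : ℝ => -h) = μ) (σ : Config n) :
    nullProb μ σ = ((2 : ℝ) ^ n)⁻¹ := by
  have h1 : ∀ τ : Config n, nullProb μ τ = nullProb μ σ := fun τ => by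
    rw [← nullProb_mul_left hμ (σ * τ⁻¹) τ]; simp
  have h2 := sum_nullProb μ (n := n)
  simp_rw [h1] at h2
  rw [Finset.sum_const, Finset.card_univ, card_config, nsmul_eq_mul] at h2
  push_cast at h2
  exact eq_inv_of_mul_eq_one_right h2

/-- The hypothesis on `ε` is meant for flips supported off `S` and for the global flip. These are
the two symmetries that kill Walsh coefficients later. -/
lemma plantedProb_mul_left (hμ : μ.map (fun h : ℝ => -h) = μ) (θ : ℝ) (S : Finset (Fin n))
    (ε σ : Config n) (hε : ∀ τ, mag S (ε * τ) ^ 2 = mag S τ ^ 2) :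
    plantedProb μ θ S (ε * σ) = plantedProb μ θ S σ := by
  unfold plantedProb
  rw [← integral_flip hμ ε _ (measurable_gibbs_plantedEnergy θ S (ε * σ))]
  refine integral_congr_ae (ae_of_all _ fun h => ?_)
  refine gibbs_congr_equiv (plantedEnergy θ S h) σ _ (Equiv.mulLeft ε) fun τ => ?_
  change _ * mag S (ε * τ) ^ 2 + nullEnergy _ (ε * τ) = _ * mag S τ ^ 2 + nullEnergy h τ
  rw [hε, nullEnergy_flip]

lemma plantedProb_perm (μ : Measure ℝ) [IsProbabilityMeasure μ] (θ : ℝ) (S : Finset (Fin n))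
    (π : Equiv.Perm (Fin n)) (σ : Config n) :
    plantedProb μ θ (S.map π.toEmbedding) σ = plantedProb μ θ S (σ ∘ π) := by
  unfold plantedProb
  have hp := measurePreserving_piCongrLeft (fun _ : Fin n => μ) π
  rw [← hp.integral_comp' (fun h => gibbs (plantedEnergy θ (S.map π.toEmbedding) h) σ)]
  refine integral_congr_ae (ae_of_all _ fun h => ?_)
  have := gibbs_congr_equiv (plantedEnergy θ S h) (σ ∘ π)
    (plantedEnergy θ (S.map π.toEmbedding) (MeasurableEquiv.piCongrLeft (fun _ : Fin n => ℝ) π h))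
    (Equiv.arrowCongr π (Equiv.refl _)) (fun τ => ?_)
  · convert this using 2
    ext i
    simp [Equiv.arrowCongr]
  · unfold plantedEnergy
    rw [Finset.card_map, Finset.sum_map]
    congr 1
    · simp [Equiv.arrowCongr]
    · rw [← Equiv.sum_comp π]
      refine Finset.sum_congr rfl fun i _ => ?_
      congr 1
      · exact MeasurableEquiv.piCongrLeft_apply_apply (β := fun _ => ℝ) π h i
      · simp [Equiv.arrowCongr]

end Prob

/-! ### Log-cosh estimates -/

/-- The second-order remainder of `log cosh` at `h`. -/
noncomputable def logCoshRem (y h : ℝ) : ℝ :=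
  Real.log (Real.cosh (y + h)) - Real.log (Real.cosh h) - y * Real.tanh h

lemma hasDerivAt_log_cosh (x : ℝ) :
    HasDerivAt (fun x => Real.log (Real.cosh x)) (Real.tanh x) x := by
  rw [Real.tanh_eq_sinh_div_cosh]
  exact (Real.hasDerivAt_cosh x).log (Real.cosh_pos x).ne'

lemma hasDerivAt_tanh (x : ℝ) : HasDerivAt Real.tanh ((1 / Real.cosh x) ^ 2) x := by
  have h := (Real.hasDerivAt_sinh x).div (Real.hasDerivAt_cosh x) (Real.cosh_pos x).ne'
  have e : Real.tanh = Real.sinh / Real.cosh := by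
    ext y; exact Real.tanh_eq_sinh_div_cosh y
  rw [e]
  refine h.congr_deriv ?_
  have := Real.cosh_sq x
  have hc := (Real.cosh_pos x).ne'
  field_simp
  linarith

lemma abs_tanh_le_one (x : ℝ) : |Real.tanh x| ≤ 1 := (Real.abs_tanh_lt_one x).le

lemma sech_sq_le_one (x : ℝ) : (1 / Real.cosh x) ^ 2 ≤ 1 := by
  have := Real.one_le_cosh x
  rw [div_pow, one_pow]
  exact div_le_one_of_le₀ (one_le_pow₀ this) (by positivity)

lemma sech_sq_eq (x : ℝ) : (1 / Real.cosh x) ^ 2 = 1 - Real.tanh x ^ 2 := by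
  rw [Real.tanh_eq_sinh_div_cosh]
  have := Real.cosh_sq x
  have hc := (Real.cosh_pos x).ne'
  field_simp
  linarith

lemma abs_tanh_sub_le (x y : ℝ) : |Real.tanh x - Real.tanh y| ≤ |x - y| := by
  have := Convex.norm_image_sub_le_of_norm_hasDerivWithin_le (f := Real.tanh)
    (f' := fun x => (1 / Real.cosh x) ^ 2) (s := Set.univ) (C := 1) (x := y) (y := x)
    (fun z _ => (hasDerivAt_tanh z).hasDerivWithinAt)
    (fun z _ => by rw [Real.norm_of_nonneg (by positivity)]; exact sech_sq_le_one z)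
    convex_univ (Set.mem_univ _) (Set.mem_univ _)
  simpa using this

/-- `sech² = 1 - tanh²`, where `tanh` is 1-Lipschitz and bounded by one. -/
lemma sech_sq_sub_le (x y : ℝ) :
    (1 / Real.cosh x) ^ 2 ≤ (1 / Real.cosh y) ^ 2 + 2 * |x - y| := by
  rw [sech_sq_eq, sech_sq_eq]
  have h1 := abs_le.1 (abs_tanh_sub_le x y)
  have h2 := abs_le.1 (abs_tanh_le_one x)
  have h3 := abs_le.1 (abs_tanh_le_one y)
  have : |Real.tanh y ^ 2 - Real.tanh x ^ 2| ≤ 2 * |x - y| := by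
    have : Real.tanh y ^ 2 - Real.tanh x ^ 2 =
      -((Real.tanh y + Real.tanh x) * (Real.tanh x - Real.tanh y)) := by ring
    rw [this, abs_neg, abs_mul]
    refine mul_le_mul ?_ (abs_tanh_sub_le x y) (abs_nonneg _) (by norm_num)
    rw [abs_le]; constructor <;> linarith
  linarith [(abs_le.1 this).2]

lemma hasDerivAt_logCoshRem (y h : ℝ) :
    HasDerivAt (fun y => logCoshRem y h) (Real.tanh (y + h) - Real.tanh h) y := by
  unfold logCoshRem
  have h1 := (hasDerivAt_log_cosh (y + h)).comp_add_const y h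
  exact ((h1.sub_const (Real.log (Real.cosh h))).sub
    ((hasDerivAt_id y).mul_const (Real.tanh h))).congr_deriv (by simp)

lemma logCoshRem_zero (h : ℝ) : logCoshRem 0 h = 0 := by simp [logCoshRem]

lemma abs_logCoshRem_sub_le (x y h : ℝ) :
    |logCoshRem x h - logCoshRem y h| ≤ 2 * |x - y| := by
  have := Convex.norm_image_sub_le_of_norm_hasDerivWithin_le (f := fun y => logCoshRem y h)
    (f' := fun y => Real.tanh (y + h) - Real.tanh h) (s := Set.univ) (C := 2) (x := y) (y := x)
    (fun z _ => (hasDerivAt_logCoshRem z h).hasDerivWithinAt)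
    (fun z _ => by
      have h2 := abs_le.1 (abs_tanh_le_one (z + h))
      have h3 := abs_le.1 (abs_tanh_le_one h)
      rw [Real.norm_eq_abs, abs_le]; constructor <;> linarith)
    convex_univ (Set.mem_univ _) (Set.mem_univ _)
  simpa using this

lemma abs_logCoshRem_le (y h : ℝ) : |logCoshRem y h| ≤ 2 * |y| := by
  simpa [logCoshRem_zero] using abs_logCoshRem_sub_le y 0 h

lemma logCoshRem_neg_neg (y h : ℝ) : logCoshRem (-y) (-h) = logCoshRem y h := by
  unfold logCoshRem
  rw [← neg_add, Real.cosh_neg, Real.cosh_neg, Real.tanh_neg]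
  ring

/-- On `[0, y]` the derivative `tanh (z + h) - tanh h` is at most `a * z`, because `sech²` grows by
at most `2 * y` there. Integrating gives the parabola. -/
lemma logCoshRem_le_of_nonneg {y : ℝ} (h : ℝ) (hy : 0 ≤ y) :
    logCoshRem y h ≤ ((1 / Real.cosh h) ^ 2 + 2 * y) * y ^ 2 / 2 := by
  set a := (1 / Real.cosh h) ^ 2 + 2 * y with ha
  have hT : ∀ z, 0 ≤ z → z ≤ y → Real.tanh (z + h) - Real.tanh h ≤ a * z := by
    intro z hz hzy
    have := Convex.norm_image_sub_le_of_norm_hasDerivWithin_le (f := Real.tanh)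
      (f' := fun x => (1 / Real.cosh x) ^ 2) (s := Set.Icc h (z + h)) (C := a) (x := h) (y := z + h)
      (fun w _ => (hasDerivAt_tanh w).hasDerivWithinAt)
      (fun w hw => by
        rw [Real.norm_of_nonneg (by positivity)]
        refine (sech_sq_sub_le w h).trans ?_
        rw [abs_of_nonneg (by linarith [hw.1])]
        linarith [hw.2])
      (convex_Icc _ _) ⟨le_rfl, by linarith⟩ ⟨by linarith, le_rfl⟩
    rw [add_sub_cancel_right, Real.norm_of_nonneg hz] at this
    exact (le_abs_self _).trans this
  have hd : ∀ z, HasDerivAt (fun z => logCoshRem z h - a * z ^ 2 / 2)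
      (Real.tanh (z + h) - Real.tanh h - a * z) z := fun z => by
    refine ((hasDerivAt_logCoshRem z h).sub
      (((hasDerivAt_pow 2 z).const_mul a).div_const 2)).congr_deriv ?_
    push_cast
    ring
  have hanti : AntitoneOn (fun z => logCoshRem z h - a * z ^ 2 / 2) (Set.Icc 0 y) := by
    refine antitoneOn_of_deriv_nonpos (convex_Icc 0 y)
      (fun z _ => (hd z).continuousAt.continuousWithinAt)
      (fun z _ => (hd z).differentiableAt.differentiableWithinAt) fun z hz => ?_
    rw [interior_Icc] at hz
    rw [(hd z).deriv]
    linarith [hT z hz.1.le hz.2.le]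
  have := hanti ⟨le_rfl, hy⟩ ⟨hy, le_rfl⟩ hy
  simp only [logCoshRem_zero] at this
  linarith

lemma logCoshRem_le (y h : ℝ) :
    logCoshRem y h ≤ ((1 / Real.cosh h) ^ 2 + 2 * |y|) * y ^ 2 / 2 := by
  rcases le_total 0 y with hy | hy
  · rw [abs_of_nonneg hy]; exact logCoshRem_le_of_nonneg h hy
  · have := logCoshRem_le_of_nonneg (-h) (neg_nonneg.2 hy)
    rw [logCoshRem_neg_neg, Real.cosh_neg, neg_sq] at this
    rwa [abs_of_nonpos hy]

lemma measurable_tanh : Measurable Real.tanh :=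
  (continuous_iff_continuousAt.2 fun x => (hasDerivAt_tanh x).continuousAt).measurable

lemma measurable_logCoshRem (y : ℝ) : Measurable (logCoshRem y) := by
  unfold logCoshRem
  have := measurable_tanh
  fun_prop

/-! ### Concentration of the field -/

section Field

open ProbabilityTheory

lemma exists_hoeffding (μ : Measure ℝ) [IsProbabilityMeasure μ] {g : ℝ → ℝ} (hg : Measurable g) {b : ℝ} (hb : 0 < b) (hgb : ∀ x, |g x| ≤ b)
    {a : ℝ} (ha : ∫ x, g x ∂μ < a) :
    ∃ c > 0, ∀ (n : ℕ) (S : Finset (Fin n)),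
      (Measure.pi fun _ : Fin n => μ).real {h | a * S.card ≤ ∑ i ∈ S, g (h i)} ≤
        Real.exp (-(c * S.card)) := by
  set e := ∫ x, g x ∂μ
  -- A variable with values in `[-b, b]` is subgaussian with parameter `b ^ 2`. A deviation `(a - e)
  -- * |S|` of a sum of `|S|` of them gives this rate.
  refine ⟨(a - e) ^ 2 / (2 * b ^ 2), by have := sub_pos.2 ha; positivity, fun n S => ?_⟩
  have hmean : ∀ i : Fin n, ∫ h : Fin n → ℝ, g (h i) ∂(Measure.pi fun _ => μ) = e := fun i => by
    have hp := measurePreserving_eval (fun _ : Fin n => μ) i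
    have := integral_map (μ := Measure.pi fun _ : Fin n => μ) (f := g)
      hp.measurable.aemeasurable hg.aestronglyMeasurable
    rw [hp.map_eq] at this
    exact this.symm
  have hind : iIndepFun (fun (i : Fin n) (h : Fin n → ℝ) => g (h i) - e)
      (Measure.pi fun _ => μ) :=
    iIndepFun_pi (μ := fun _ : Fin n => μ) (X := fun _ x => g x - e)
      fun i => (hg.sub_const e).aemeasurable
  have hsub : ∀ i ∈ S, HasSubgaussianMGF (fun h : Fin n → ℝ => g (h i) - e)
      ((‖b - -b‖₊ / 2) ^ 2) (Measure.pi fun _ => μ) := fun i _ => by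
    rw [← hmean i]
    exact hasSubgaussianMGF_of_mem_Icc
      (hg.comp (measurable_pi_apply i)).aemeasurable (ae_of_all _ fun h => abs_le.1 (hgb (h i)))
  have key := HasSubgaussianMGF.measure_sum_ge_le_of_iIndepFun hind hsub
    (ε := (a - e) * S.card) (mul_nonneg (sub_pos.2 ha).le (Nat.cast_nonneg _))
  refine le_trans (le_of_eq ?_) (key.trans (Real.exp_le_exp.2 (le_of_eq ?_)))
  · congr 1
    ext h
    simp only [Set.mem_ofPred_eq, Finset.sum_sub_distrib, Finset.sum_const, nsmul_eq_mul]
    constructor <;> intro H <;> linarith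
  · have hb2 : ‖b - -b‖ = 2 * b := by
      rw [Real.norm_of_nonneg (by linarith)]; ring
    rw [Finset.sum_const, nsmul_eq_mul]
    push_cast
    rw [hb2]
    rcases Nat.eq_zero_or_pos S.card with h0 | h0
    · simp [h0]
    · have : (S.card : ℝ) ≠ 0 := by positivity
      field_simp

/-- Outside a set of fields of exponentially small probability, the empirical second-order
remainder of `log cosh` stays below `q y² / 2` on the set `s`, for some `q < 1 / θ`. -/
def RemControlled (μ : Measure ℝ) (θ : ℝ) (s : Set ℝ) : Prop :=
  ∃ δ > 0, δ < 1 ∧ ∃ c > 0, ∃ C > 0, ∀ (n : ℕ) (S : Finset (Fin n)), ∃ B : Set (Fin n → ℝ),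
    MeasurableSet B ∧
    (Measure.pi fun _ : Fin n => μ).real B ≤ C * Real.exp (-(c * S.card)) ∧
    ∀ h ∉ B, ∀ y ∈ s, ∑ i ∈ S, logCoshRem y (h i) ≤ S.card * ((1 - δ) * y ^ 2 / (2 * θ))

variable {μ : Measure ℝ}

/-- Stability under subsets, and under finite unions below, is what the compactness induction in
`remControlled_univ` consumes. -/
lemma RemControlled.mono {θ : ℝ} {s t : Set ℝ} (hst : s ⊆ t) (ht : RemControlled μ θ t) :
    RemControlled μ θ s := by
  obtain ⟨δ, h1, h2, c, h3, C, h4, H⟩ := ht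
  refine ⟨δ, h1, h2, c, h3, C, h4, fun n S => ?_⟩
  obtain ⟨B, hB, hB', hB''⟩ := H n S
  exact ⟨B, hB, hB', fun h hh y hy => hB'' h hh y (hst hy)⟩

lemma RemControlled.union {θ : ℝ} (hθ : 0 < θ) {s t : Set ℝ} (hs : RemControlled μ θ s)
    (ht : RemControlled μ θ t) : RemControlled μ θ (s ∪ t) := by
  obtain ⟨δ, h1, h2, c, h3, C, h4, H⟩ := hs
  obtain ⟨δ', h1', h2', c', h3', C', h4', H'⟩ := ht
  refine ⟨min δ δ', lt_min h1 h1', (min_le_left _ _).trans_lt h2, min c c', lt_min h3 h3',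
    C + C', by positivity, fun n S => ?_⟩
  obtain ⟨B, hB, hBp, hBy⟩ := H n S
  obtain ⟨B', hB', hBp', hBy'⟩ := H' n S
  have hmono : ∀ {d : ℝ} (y : ℝ), min δ δ' ≤ d →
      (S.card : ℝ) * ((1 - d) * y ^ 2 / (2 * θ)) ≤
        S.card * ((1 - min δ δ') * y ^ 2 / (2 * θ)) := fun y hd => by gcongr
  refine ⟨B ∪ B', hB.union hB', ?_, fun h hh y hy => ?_⟩
  · refine (measureReal_union_le _ _).trans ?_
    rw [add_mul]
    refine add_le_add (hBp.trans ?_) (hBp'.trans ?_)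
    · gcongr; exact min_le_left _ _
    · gcongr; exact min_le_right _ _
  · rw [Set.mem_union, not_or] at hh
    rcases hy with hy | hy
    · exact (hBy h hh.1 y hy).trans (hmono y (min_le_left _ _))
    · exact (hBy' h hh.2 y hy).trans (hmono y (min_le_right _ _))

/-- The remainder is controlled near a point `x ≠ 0` where its mean is below `x² / (2θ)`. -/
lemma remControlled_nhds_of_ne_zero [IsProbabilityMeasure μ] {θ x : ℝ} (hθ : 0 < θ) (hx : x ≠ 0)
    (h : ∫ h, logCoshRem x h ∂μ < x ^ 2 / (2 * θ)) :
    ∃ t ∈ nhds x, RemControlled μ θ t := by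
  obtain ⟨a, ha1, ha2⟩ := exists_between h
  obtain ⟨c, hc, H⟩ := exists_hoeffding μ (measurable_logCoshRem x) (b := 2 * |x|) (by positivity)
    (abs_logCoshRem_le x) ha1
  have hx2 : 0 < x ^ 2 / (2 * θ) := by positivity
  obtain ⟨δ, hδ0, hδ1, hδ⟩ : ∃ δ > 0, δ < 1 ∧ a < (1 - δ) * x ^ 2 / (2 * θ) := by
    have h1 : ∀ᶠ δ in nhdsWithin (0 : ℝ) (Set.Ioi 0), a < (1 - δ) * x ^ 2 / (2 * θ) := by
      have : Tendsto (fun δ : ℝ => (1 - δ) * x ^ 2 / (2 * θ)) (nhdsWithin (0 : ℝ) (Set.Ioi 0))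
          (nhds ((1 - 0) * x ^ 2 / (2 * θ))) :=
        tendsto_nhdsWithin_of_tendsto_nhds (Continuous.tendsto (by fun_prop) _)
      exact this.eventually (lt_mem_nhds (by simpa using ha2))
    obtain ⟨δ, h2, h3⟩ := (h1.and (Ioo_mem_nhdsGT (zero_lt_one' ℝ))).exists
    exact ⟨δ, h3.1, h3.2, h2⟩
  -- The remainder is 2-Lipschitz in `y` uniformly in the field, so the single Hoeffding event at
  -- `x` serves a whole neighbourhood of `x`.
  have hcont : ∀ᶠ y in nhds x, a + 2 * |y - x| < (1 - δ) * y ^ 2 / (2 * θ) := by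
    have : Tendsto (fun y : ℝ => (1 - δ) * y ^ 2 / (2 * θ) - 2 * |y - x|) (nhds x)
        (nhds ((1 - δ) * x ^ 2 / (2 * θ) - 2 * |x - x|)) :=
      Continuous.tendsto (by fun_prop) _
    filter_upwards [this.eventually (lt_mem_nhds (a := a) (by simpa using hδ))] with y hy
    linarith
  refine ⟨_, hcont, δ, hδ0, hδ1, c, hc, 1, one_pos, fun n S =>
    ⟨{h | a * S.card ≤ ∑ i ∈ S, logCoshRem x (h i)}, ?_, ?_, fun h hh y hy => ?_⟩⟩
  · refine measurableSet_le measurable_const (Finset.measurable_fun_sum _ fun i _ => ?_)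
    exact (measurable_logCoshRem x).comp (measurable_pi_apply i)
  · rw [one_mul]; exact H n S
  · have hh' : ∑ i ∈ S, logCoshRem x (h i) < a * S.card := not_le.1 hh
    have hy' : a + 2 * |y - x| < (1 - δ) * y ^ 2 / (2 * θ) := hy
    have h1 : ∑ i ∈ S, logCoshRem y (h i) ≤ ∑ i ∈ S, (logCoshRem x (h i) + 2 * |y - x|) :=
      Finset.sum_le_sum fun i _ => by
        linarith [(abs_le.1 (abs_logCoshRem_sub_le y x (h i))).2]
    rw [Finset.sum_add_distrib, Finset.sum_const, nsmul_eq_mul] at h1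
    have h2 : (S.card : ℝ) * (a + 2 * |y - x|) ≤ S.card * ((1 - δ) * y ^ 2 / (2 * θ)) := by
      gcongr
    linarith

/-- The remainder is controlled near `0` when `θ E[sech² h] < 1`. -/
lemma remControlled_nhds_zero [IsProbabilityMeasure μ] {θ : ℝ} (hθ : 0 < θ) (h : meanSechSq μ < 1 / θ) :
    ∃ t ∈ nhds (0 : ℝ), RemControlled μ θ t := by
  obtain ⟨a, ha1, ha2⟩ := exists_between h
  have hcm : Measurable fun h : ℝ => (1 / Real.cosh h) ^ 2 := by fun_prop
  -- Both sides vanish quadratically at `y = 0`, so a Lipschitz estimate is useless here. The event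
  -- controls the empirical mean of the second derivative instead.
  obtain ⟨c, hc, H⟩ := exists_hoeffding μ hcm (b := 1) one_pos
    (fun x => by rw [abs_of_nonneg (by positivity)]; exact sech_sq_le_one x) ha1
  obtain ⟨δ, hδ0, hδ1, hδ⟩ : ∃ δ > 0, δ < 1 ∧ a < (1 - δ) / θ := by
    have h1 : ∀ᶠ δ in nhdsWithin (0 : ℝ) (Set.Ioi 0), a < (1 - δ) / θ := by
      have : Tendsto (fun δ : ℝ => (1 - δ) / θ) (nhdsWithin (0 : ℝ) (Set.Ioi 0))
          (nhds ((1 - 0) / θ)) :=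
        tendsto_nhdsWithin_of_tendsto_nhds (Continuous.tendsto (by fun_prop) _)
      exact this.eventually (lt_mem_nhds (by simpa using ha2))
    obtain ⟨δ, h2, h3⟩ := (h1.and (Ioo_mem_nhdsGT (zero_lt_one' ℝ))).exists
    exact ⟨δ, h3.1, h3.2, h2⟩
  have hcont : ∀ᶠ y in nhds (0 : ℝ), a + 2 * |y| < (1 - δ) / θ := by
    have : Tendsto (fun y : ℝ => a + 2 * |y|) (nhds 0) (nhds (a + 2 * |0|)) :=
      Continuous.tendsto (by fun_prop) _
    exact this.eventually (gt_mem_nhds (by simpa using hδ))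
  refine ⟨_, hcont, δ, hδ0, hδ1, c, hc, 1, one_pos, fun n S =>
    ⟨{h | a * S.card ≤ ∑ i ∈ S, (1 / Real.cosh (h i)) ^ 2}, ?_, ?_, fun h hh y hy => ?_⟩⟩
  · refine measurableSet_le measurable_const (Finset.measurable_fun_sum _ fun i _ => ?_)
    exact hcm.comp (measurable_pi_apply i)
  · rw [one_mul]; exact H n S
  · have hh' : ∑ i ∈ S, (1 / Real.cosh (h i)) ^ 2 < a * S.card := not_le.1 hh
    have hy' : a + 2 * |y| < (1 - δ) / θ := hy
    have h1 : ∑ i ∈ S, logCoshRem y (h i) ≤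
        ∑ i ∈ S, ((1 / Real.cosh (h i)) ^ 2 + 2 * |y|) * (y ^ 2 / 2) :=
      Finset.sum_le_sum fun i _ => by linarith [logCoshRem_le y (h i)]
    rw [← Finset.sum_mul, Finset.sum_add_distrib, Finset.sum_const, nsmul_eq_mul] at h1
    have h2 : (∑ i ∈ S, (1 / Real.cosh (h i)) ^ 2 + S.card * (2 * |y|)) * (y ^ 2 / 2) ≤
        (S.card * ((1 - δ) / θ)) * (y ^ 2 / 2) := by
      gcongr
      have : (S.card : ℝ) * (a + 2 * |y|) ≤ S.card * ((1 - δ) / θ) := by gcongr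
      linarith
    refine (h1.trans h2).trans (le_of_eq ?_)
    field_simp

/-- The remainder grows at most like `2 * |y|`, which the parabola `y ^ 2 / (4 * θ)` overtakes at
`|y| = 8 * θ`. No exceptional fields are needed. -/
lemma remControlled_of_large {θ : ℝ} (hθ : 0 < θ) :
    RemControlled μ θ {y : ℝ | 8 * θ ≤ |y|} := by
  refine ⟨1 / 2, by norm_num, by norm_num, 1, one_pos, 1, one_pos, fun n S =>
    ⟨∅, MeasurableSet.empty, by simp [Real.exp_nonneg], fun h _ y hy => ?_⟩⟩
  have hy' : 8 * θ ≤ |y| := hy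
  have h1 : ∀ i ∈ S, logCoshRem y (h i) ≤ (1 - 1 / 2) * y ^ 2 / (2 * θ) := fun i _ => by
    refine ((le_abs_self _).trans (abs_logCoshRem_le y (h i))).trans ?_
    rw [le_div_iff₀ (by positivity), ← sq_abs y]
    nlinarith [abs_nonneg y]
  simpa using Finset.sum_le_sum h1

lemma integral_tanh_eq_zero (hμ : μ.map (fun h : ℝ => -h) = μ) : ∫ h, Real.tanh h ∂μ = 0 := by
  have h1 : ∫ h, Real.tanh h ∂μ = ∫ h, Real.tanh (-h) ∂μ := by
    conv_lhs => rw [← hμ]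
    exact integral_map measurable_neg.aemeasurable measurable_tanh.aestronglyMeasurable
  simp_rw [Real.tanh_neg, integral_neg] at h1
  linarith

/-- This is strict minimality of the potential at `0`, evaluated at `y / √θ`. The linear term
separating `logCoshRem` from the integrand has mean zero since `tanh` is odd. -/
lemma integral_logCoshRem_lt [IsProbabilityMeasure μ] (hμ : μ.map (fun h : ℝ => -h) = μ) {θ : ℝ}
    (hθ : HighTemperature μ θ) {y : ℝ} (hy : y ≠ 0) :
    ∫ h, logCoshRem y h ∂μ < y ^ 2 / (2 * θ) := by
  obtain ⟨h0, -, hmin⟩ := hθ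
  have hs := Real.sqrt_pos.2 h0
  have := hmin (y / Real.sqrt θ) (div_ne_zero hy hs.ne')
  unfold potential at this
  simp only [mul_zero, zero_add, sub_self, integral_zero, mul_div_cancel₀ y hs.ne'] at this
  rw [div_pow, Real.sq_sqrt h0.le] at this
  have htanh : Integrable (fun h => y * Real.tanh h) μ :=
    (Integrable.of_bound measurable_tanh.aestronglyMeasurable 1
      (ae_of_all _ fun h => abs_tanh_le_one h)).const_mul y
  have hrem : Integrable (logCoshRem y) μ :=
    Integrable.of_bound (measurable_logCoshRem y).aestronglyMeasurable (2 * |y|)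
      (ae_of_all _ fun h => abs_logCoshRem_le y h)
  have e : ∀ h, Real.log (Real.cosh (y + h)) - Real.log (Real.cosh h) =
      logCoshRem y h + y * Real.tanh h := fun h => by unfold logCoshRem; ring
  simp_rw [e] at this
  rw [integral_add hrem htanh, integral_const_mul, integral_tanh_eq_zero hμ] at this
  have e2 : y ^ 2 / θ / 2 = y ^ 2 / (2 * θ) := by field_simp
  rw [e2] at this
  linarith

lemma meanSechSq_lt (θ : ℝ) (hθ : HighTemperature μ θ) : meanSechSq μ < 1 / θ := by
  obtain ⟨h0, h1, -⟩ := hθ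
  -- Otherwise `1 / meanSechSq μ` would be nonpositive (with value `0` at zero), against `0 < θ < 1
  -- / meanSechSq μ`.
  have hpos : 0 < meanSechSq μ := by
    by_contra hneg
    have := one_div_nonpos.2 (not_lt.1 hneg)
    linarith
  rw [lt_div_iff₀ hpos] at h1
  rw [lt_div_iff₀ h0]
  linarith

/-- Three local reasons are glued together: the curvature bound at `0`, strict minimality at other
points of the compact interval `[-8θ, 8θ]`, and linear growth outside it. -/
theorem remControlled_univ [IsProbabilityMeasure μ] (hμ : μ.map (fun h : ℝ => -h) = μ) {θ : ℝ}
    (hθ : HighTemperature μ θ) : RemControlled μ θ Set.univ := by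
  have h0 := hθ.1
  have hc : RemControlled μ θ (Set.Icc (-(8 * θ)) (8 * θ)) := by
    refine isCompact_Icc.induction_on ?_ (fun s t hst ht => ht.mono hst)
      (fun s t hs ht => hs.union h0 ht) fun x _ => ?_
    · exact (remControlled_of_large h0).mono (Set.empty_subset _)
    · suffices h : ∃ t ∈ nhds x, RemControlled μ θ t by
        obtain ⟨t, ht, h⟩ := h
        exact ⟨t, mem_nhdsWithin_of_mem_nhds ht, h⟩
      rcases eq_or_ne x 0 with rfl | hx
      · exact remControlled_nhds_zero h0 (meanSechSq_lt θ hθ)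
      · exact remControlled_nhds_of_ne_zero h0 hx (integral_logCoshRem_lt hμ hθ hx)
  refine (hc.union h0 (remControlled_of_large h0)).mono fun y _ => ?_
  rcases le_total (8 * θ) |y| with h | h
  · exact Or.inr h
  · exact Or.inl (abs_le.1 h)

end Field

/-! ### Exponential moments of the magnetization -/

lemma exp_neg_sq_add_eq {k : ℝ} (hk : 0 < k) (t x : ℝ) :
    Real.exp (-(k * x ^ 2 / 2) + t * x) =
      Real.exp (t ^ 2 / (2 * k)) * Real.exp (-(k / 2) * (x - t / k) ^ 2) := by
  rw [← Real.exp_add]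
  congr 1
  field_simp
  ring

lemma integrable_exp_neg_sq_add {k : ℝ} (hk : 0 < k) (t : ℝ) :
    Integrable fun x : ℝ => Real.exp (-(k * x ^ 2 / 2) + t * x) := by
  simp_rw [exp_neg_sq_add_eq hk]
  exact ((integrable_exp_neg_mul_sq (half_pos hk)).comp_sub_right (t / k)).const_mul _

lemma integral_exp_neg_sq_add {k : ℝ} (hk : 0 < k) (t : ℝ) :
    ∫ x : ℝ, Real.exp (-(k * x ^ 2 / 2) + t * x) =
      √(2 * Real.pi / k) * Real.exp (t ^ 2 / (2 * k)) := by
  simp_rw [exp_neg_sq_add_eq hk]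
  rw [integral_const_mul, integral_sub_right_eq_self (fun x => Real.exp (-(k / 2) * x ^ 2)),
    integral_gaussian, mul_comm]
  congr 2
  field_simp

/-- Spins are independent given the field, and a site of `S` contributes `cosh (y + h) / cosh h`,
whose logarithm is `logCoshRem y h + y * tanh h`. -/
lemma sum_gibbs_exp_mag {n : ℕ} (S : Finset (Fin n)) (h : Fin n → ℝ) (y : ℝ) :
    ∑ σ, gibbs (nullEnergy h) σ * Real.exp (y * mag S σ) =
      Real.exp (∑ i ∈ S, logCoshRem y (h i) + y * ∑ i ∈ S, Real.tanh (h i)) := by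
  have h1 : ∀ σ : Config n, gibbs (nullEnergy h) σ * Real.exp (y * mag S σ) =
      ∏ i, (Real.exp (h i * spin (σ i)) / (2 * Real.cosh (h i)) *
        if i ∈ S then Real.exp (y * spin (σ i)) else 1) := fun σ => by
    rw [Finset.prod_mul_distrib, gibbs_nullEnergy, mag, Finset.mul_sum, Real.exp_sum,
      Finset.prod_ite_mem, Finset.univ_inter]
  simp_rw [h1]
  rw [sum_config_prod (fun i s => Real.exp (h i * spin s) / (2 * Real.cosh (h i)) *
        if i ∈ S then Real.exp (y * spin s) else 1)]
  have h2 : ∀ i, (Real.exp (h i * spin 1) / (2 * Real.cosh (h i)) *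
        (if i ∈ S then Real.exp (y * spin 1) else 1) +
      Real.exp (h i * spin (-1)) / (2 * Real.cosh (h i)) *
        (if i ∈ S then Real.exp (y * spin (-1)) else 1)) =
      if i ∈ S then Real.exp (logCoshRem y (h i) + y * Real.tanh (h i)) else 1 := fun i => by
    have hc := (Real.cosh_pos (h i)).ne'
    rw [spin_neg, spin_one]
    split_ifs
    · rw [logCoshRem, sub_add_cancel, Real.exp_sub, Real.exp_log (Real.cosh_pos _),
        Real.exp_log (Real.cosh_pos _), Real.cosh_eq (y + h i)]
      rw [mul_one, mul_one, div_mul_eq_mul_div, div_mul_eq_mul_div, ← Real.exp_add,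
        ← Real.exp_add, ← add_div, div_div, show h i + y = y + h i by ring,
        show h i * -1 + y * -1 = -(y + h i) by ring]
    · rw [mul_one, mul_one, mul_one, ← add_div, Real.cosh_eq, mul_neg_one]
      have := Real.exp_pos (h i)
      have := Real.exp_pos (-h i)
      field_simp
  simp_rw [h2]
  rw [Finset.prod_ite_mem, Finset.univ_inter, ← Real.exp_sum, Finset.sum_add_distrib,
    ← Finset.mul_sum]

/-- Hubbard--Stratonovich bound for the Gaussian moment of the magnetization in a field whose
`log cosh` remainder is dominated by a parabola. -/
lemma sum_gibbs_exp_mag_sq_le {n : ℕ} {S : Finset (Fin n)} (hS : S.Nonempty) (h : Fin n → ℝ)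
    {β a : ℝ} (hβ : 0 ≤ β) (hβa : β * a < 1)
    (H : ∀ y, ∑ i ∈ S, logCoshRem y (h i) ≤ S.card * (a * y ^ 2 / 2)) :
    ∑ σ, gibbs (nullEnergy h) σ * Real.exp (β / (2 * (S.card : ℝ)) * mag S σ ^ 2) ≤
      √(2 / (1 - β * a)) *
        Real.exp (β / (1 - β * a) * ((∑ i ∈ S, Real.tanh (h i)) ^ 2 / S.card)) := by
  set k : ℝ := (S.card : ℝ) with hkdef
  have hk : 0 < k := by rw [hkdef]; exact_mod_cast hS.card_pos
  set τ := ∑ i ∈ S, Real.tanh (h i)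
  set d := 1 - β * a with hd
  have hd0 : 0 < d := by linarith
  have hb := Real.sq_sqrt hβ
  set b := √β
  have hpi := Real.pi_pos
  -- Hubbard–Stratonovich: `exp (β / (2k) * mag²)` is the Gaussian average of `exp (b x mag)` for
  -- `x` of variance `1 / k`, with `b = √β`.
  have h2 : √(2 * Real.pi / k) *
      ∑ σ, gibbs (nullEnergy h) σ * Real.exp (β / (2 * k) * mag S σ ^ 2) =
      ∫ x : ℝ, Real.exp (-(k * x ^ 2 / 2)) *
        Real.exp (∑ i ∈ S, logCoshRem (b * x) (h i) + b * x * τ) := by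
    have hg : ∀ y, Real.exp (∑ i ∈ S, logCoshRem y (h i) + y * τ) =
        ∑ σ, gibbs (nullEnergy h) σ * Real.exp (y * mag S σ) :=
      fun y => (sum_gibbs_exp_mag S h y).symm
    simp_rw [hg, Finset.mul_sum]
    have e : ∀ (σ : Config n) (x : ℝ), Real.exp (-(k * x ^ 2 / 2)) *
        (gibbs (nullEnergy h) σ * Real.exp (b * x * mag S σ)) =
        gibbs (nullEnergy h) σ * Real.exp (-(k * x ^ 2 / 2) + b * mag S σ * x) := fun σ x => by
      rw [Real.exp_add]; ring_nf
    simp_rw [e]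
    rw [integral_finsetSum _ fun σ _ => (integrable_exp_neg_sq_add hk _).const_mul _]
    refine Finset.sum_congr rfl fun σ _ => ?_
    rw [integral_const_mul, integral_exp_neg_sq_add hk, mul_pow, hb]
    ring_nf
  have h3 : ∫ x : ℝ, Real.exp (-(k * x ^ 2 / 2)) *
        Real.exp (∑ i ∈ S, logCoshRem (b * x) (h i) + b * x * τ) ≤
      ∫ x : ℝ, Real.exp (β / d * (τ ^ 2 / k)) * Real.exp (-(k * d / 4) * x ^ 2) := by
    refine integral_mono_of_nonneg (ae_of_all _ fun x => by positivity)
      ((integrable_exp_neg_mul_sq (by positivity)).const_mul _) (ae_of_all _ fun x => ?_)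
    simp only
    rw [← Real.exp_add, ← Real.exp_add]
    refine Real.exp_le_exp.2 ?_
    have h4 := H (b * x)
    rw [mul_pow, hb] at h4
    -- The available curvature is `k * d / 2`. Half of it absorbs the linear term `b x τ` by
    -- completing the square, and the other half keeps the integral finite.
    have h5 : β / d * (τ ^ 2 / k) + k * d / 4 * x ^ 2 - b * x * τ =
        (b * τ - k * d * x / 2) ^ 2 / (k * d) := by
      rw [← hb]; field_simp; ring
    have h6 : 0 ≤ (b * τ - k * d * x / 2) ^ 2 / (k * d) := by positivity
    have h7 : k * (a * (β * x ^ 2) / 2) = k * x ^ 2 / 2 - k * d * x ^ 2 / 2 := by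
      rw [hd]; ring
    linarith
  rw [integral_const_mul, integral_gaussian] at h3
  have h8 : √(Real.pi / (k * d / 4)) = √(2 * Real.pi / k) * √(2 / d) := by
    rw [← Real.sqrt_mul (by positivity)]
    congr 1
    field_simp
    norm_num
  rw [h8] at h3
  have h9 : 0 < √(2 * Real.pi / k) := Real.sqrt_pos.2 (by positivity)
  refine le_of_mul_le_mul_left ?_ h9
  rw [h2]
  refine h3.trans (le_of_eq (by ring))

lemma logCoshRem_zero_right_le (y : ℝ) : logCoshRem y 0 ≤ y ^ 2 / 2 := by
  have : Real.log (Real.cosh y) ≤ y ^ 2 / 2 :=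
    (Real.log_le_iff_le_exp (Real.cosh_pos y)).2 (Real.cosh_le_exp_half_sq y)
  simpa [logCoshRem] using this

lemma gibbs_nullEnergy_zero {n : ℕ} (σ : Config n) :
    gibbs (nullEnergy fun _ => 0) σ = ((2 : ℝ) ^ n)⁻¹ := by
  rw [gibbs_nullEnergy]
  simp

lemma uniform_exp_mag_sq_le {n : ℕ} {S : Finset (Fin n)} (hS : S.Nonempty) {β : ℝ}
    (hβ : 0 ≤ β) (hβ1 : β < 1) :
    ∑ σ : Config n, ((2 : ℝ) ^ n)⁻¹ * Real.exp (β / (2 * (S.card : ℝ)) * mag S σ ^ 2) ≤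
      √(2 / (1 - β)) := by
  have := sum_gibbs_exp_mag_sq_le hS (fun _ => 0) (a := 1) hβ (by rwa [mul_one]) fun y => by
    simpa using mul_le_mul_of_nonneg_left (logCoshRem_zero_right_le y) (Nat.cast_nonneg (α := ℝ) S.card)
  simpa [gibbs_nullEnergy_zero] using this

/-- Differentiate the moment generating function at `y = 0`, where the remainder has zero
derivative. -/
lemma sum_gibbs_mag {n : ℕ} (S : Finset (Fin n)) (h : Fin n → ℝ) :
    ∑ σ, gibbs (nullEnergy h) σ * mag S σ = ∑ i ∈ S, Real.tanh (h i) := by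
  have h1 : HasDerivAt (fun y => ∑ σ, gibbs (nullEnergy h) σ * Real.exp (y * mag S σ))
      (∑ σ, gibbs (nullEnergy h) σ * mag S σ) 0 := by
    refine HasDerivAt.fun_sum fun σ _ => ?_
    have := (((hasDerivAt_id (0 : ℝ)).mul_const (mag S σ)).exp).const_mul
      (gibbs (nullEnergy h) σ)
    simpa using this
  simp_rw [sum_gibbs_exp_mag] at h1
  have h2 : HasDerivAt (fun y => ∑ i ∈ S, logCoshRem y (h i) + y * ∑ i ∈ S, Real.tanh (h i))
      (∑ i ∈ S, (Real.tanh (0 + h i) - Real.tanh (h i)) + 1 * ∑ i ∈ S, Real.tanh (h i)) 0 :=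
    (HasDerivAt.fun_sum fun i _ => hasDerivAt_logCoshRem 0 (h i)).add
      ((hasDerivAt_id (0 : ℝ)).mul_const _)
  have := h1.unique h2.exp
  simpa [logCoshRem_zero] using this

/-- Jensen twice, for the square and for `exp`. It trades the fluctuation of the field for a spin
moment, whose field average is a moment of uniform spins. -/
lemma exp_sq_sum_tanh_le {n : ℕ} (S : Finset (Fin n)) (h : Fin n → ℝ) {c : ℝ} (hc : 0 ≤ c) :
    Real.exp (c * (∑ i ∈ S, Real.tanh (h i)) ^ 2) ≤
      ∑ σ, gibbs (nullEnergy h) σ * Real.exp (c * mag S σ ^ 2) := by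
  have h0 : ∀ σ ∈ (Finset.univ : Finset (Config n)), 0 ≤ gibbs (nullEnergy h) σ :=
    fun σ _ => (gibbs_pos _ σ).le
  have h1 := convexOn_exp.map_sum_le h0 (sum_gibbs (nullEnergy h))
    (p := fun σ => c * mag S σ ^ 2) fun _ _ => Set.mem_univ _
  have h2 := (even_two.convexOn_pow (𝕜 := ℝ)).map_sum_le h0 (sum_gibbs (nullEnergy h))
    (p := fun σ => mag S σ) fun _ _ => Set.mem_univ _
  simp only [smul_eq_mul] at h1 h2
  refine le_trans (Real.exp_le_exp.2 ?_) h1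
  rw [← sum_gibbs_mag S h]
  refine (mul_le_mul_of_nonneg_left h2 hc).trans (le_of_eq ?_)
  rw [Finset.mul_sum]
  exact Finset.sum_congr rfl fun σ _ => by ring

/-- Under the planted model at high temperature, the normalized magnetization of the clique has
a Gaussian moment, uniformly in the clique and in the dimension. -/
theorem exists_exp_moment {μ : Measure ℝ} [IsProbabilityMeasure μ]
    (hμ : μ.map (fun h : ℝ => -h) = μ) {θ : ℝ} (hθ : HighTemperature μ θ) :
    ∃ c > 0, ∃ C, ∀ (n : ℕ) (S : Finset (Fin n)), S.Nonempty →
      ∑ σ, plantedProb μ θ S σ * Real.exp (c * (mag S σ ^ 2 / S.card)) ≤ C := by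
  have hθ0 := hθ.1
  obtain ⟨δ, hδ0, hδ1, c₀, hc₀, C₀, hC₀, H⟩ := remControlled_univ hμ hθ
  -- The excess `θ * δ` over the true coupling pays for the Gaussian moment, while `β * (1 - δ) / θ
  -- = 1 - δ ^ 2` stays below one.
  set β := θ * (1 + δ) with hβ
  set A := √(2 / δ ^ 2) with hA
  set D := β / δ ^ 2 with hD
  have hβ0 : 0 < β := by positivity
  have hD0 : 0 < D := by positivity
  have hA1 : 1 ≤ A := by
    rw [hA, Real.one_le_sqrt, le_div_iff₀ (by positivity)]
    nlinarith
  -- The constant `D` may be too large for `exp (D τ² / k)` to have a bounded mean. Raising to the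
  -- power `s` lowers it to at most `1 / 4`.
  set s := min 1 (1 / (4 * D)) with hs
  have hs0 : 0 < s := lt_min one_pos (by positivity)
  have hs1 : s ≤ 1 := min_le_left _ _
  have hsD : s * D ≤ 1 / 4 := by
    have : s ≤ 1 / (4 * D) := min_le_right _ _
    rw [le_div_iff₀ (by positivity)] at this
    linarith
  -- With `c ≤ c₀`, the trivial bound `exp (c₀ k)` on exceptional fields cancels against their
  -- probability. The other bound lets the power mean inequality apply on good fields.
  set c := min c₀ (s * (θ * δ / 2)) with hc
  have hc0 : 0 < c := lt_min hc₀ (by positivity)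
  refine ⟨c, hc0, C₀ + A * 2, fun n S hS => ?_⟩
  obtain ⟨B, hB, hBp, hBh⟩ := H n S
  have hk : (0 : ℝ) < S.card := by exact_mod_cast hS.card_pos
  have hgood : ∀ h ∉ B, ∑ σ, gibbs (plantedEnergy θ S h) σ *
      Real.exp (c * (mag S σ ^ 2 / S.card)) ≤
      A * ∑ σ, gibbs (nullEnergy h) σ * Real.exp (1 / 2 / (2 * (S.card : ℝ)) * mag S σ ^ 2) := by
    intro h hh
    have h1 : ∑ σ, gibbs (nullEnergy h) σ * Real.exp (β / (2 * (S.card : ℝ)) * mag S σ ^ 2) ≤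
        A * Real.exp (D * ((∑ i ∈ S, Real.tanh (h i)) ^ 2 / S.card)) := by
      have hba : 1 - β * ((1 - δ) / θ) = δ ^ 2 := by rw [hβ]; field_simp; ring
      have := sum_gibbs_exp_mag_sq_le hS h (a := (1 - δ) / θ) hβ0.le
        (by have : 0 < δ ^ 2 := by positivity
            linarith)
        (fun y => (hBh h hh y (Set.mem_univ y)).trans (le_of_eq (by field_simp)))
      rwa [hba] at this
    have h2 : ∑ σ, gibbs (plantedEnergy θ S h) σ *
        Real.exp (θ * δ / 2 * (mag S σ ^ 2 / S.card)) ≤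
        A * Real.exp (D * ((∑ i ∈ S, Real.tanh (h i)) ^ 2 / S.card)) := by
      refine le_trans (Finset.sum_le_sum fun σ _ => ?_) h1
      refine (mul_le_mul_of_nonneg_right (gibbs_plantedEnergy_le hθ0.le S h σ)
        (Real.exp_pos _).le).trans (le_of_eq ?_)
      rw [mul_assoc, ← Real.exp_add]
      congr 2
      rw [hβ]; field_simp
    have h3 := Real.arith_mean_le_rpow_mean Finset.univ (gibbs (plantedEnergy θ S h))
      (fun σ => Real.exp (s * (θ * δ / 2 * (mag S σ ^ 2 / S.card))))
      (fun σ _ => (gibbs_pos _ σ).le) (sum_gibbs _) (fun σ _ => (Real.exp_pos _).le)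
      (p := 1 / s) (by rw [le_div_iff₀ hs0]; linarith)
    simp_rw [← Real.exp_mul] at h3
    rw [one_div_one_div] at h3
    have e : ∀ σ, s * (θ * δ / 2 * (mag S σ ^ 2 / S.card)) * (1 / s) =
        θ * δ / 2 * (mag S σ ^ 2 / S.card) := fun σ => by field_simp
    simp_rw [e] at h3
    calc _ ≤ ∑ σ, gibbs (plantedEnergy θ S h) σ *
          Real.exp (s * (θ * δ / 2 * (mag S σ ^ 2 / S.card))) := by
          refine Finset.sum_le_sum fun σ _ => mul_le_mul_of_nonneg_left ?_ (gibbs_pos _ σ).le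
          refine Real.exp_le_exp.2 ?_
          rw [← mul_assoc]
          exact mul_le_mul_of_nonneg_right (min_le_right _ _) (by positivity)
      _ ≤ (A * Real.exp (D * ((∑ i ∈ S, Real.tanh (h i)) ^ 2 / S.card))) ^ s :=
          h3.trans (Real.rpow_le_rpow (Finset.sum_nonneg fun σ _ =>
            mul_nonneg (gibbs_pos _ σ).le (Real.exp_pos _).le) h2 hs0.le)
      _ = A ^ s * Real.exp (s * D * ((∑ i ∈ S, Real.tanh (h i)) ^ 2 / S.card)) := by
          rw [Real.mul_rpow (by positivity) (Real.exp_pos _).le, ← Real.exp_mul]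
          ring_nf
      _ ≤ A * Real.exp (1 / 2 / (2 * (S.card : ℝ)) * (∑ i ∈ S, Real.tanh (h i)) ^ 2) := by
          refine mul_le_mul (Real.rpow_le_self_of_one_le hA1 hs1) (Real.exp_le_exp.2 ?_)
            (Real.exp_pos _).le (by positivity)
          refine (mul_le_mul_of_nonneg_right hsD (by positivity)).trans (le_of_eq ?_)
          field_simp
          ring
      _ ≤ _ := by
          gcongr
          exact exp_sq_sum_tanh_le S h (by positivity)
  have hbad : ∀ h : Fin n → ℝ, ∑ σ, gibbs (plantedEnergy θ S h) σ *
      Real.exp (c * (mag S σ ^ 2 / S.card)) ≤ Real.exp (c₀ * S.card) := fun h => by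
    calc _ ≤ ∑ σ, gibbs (plantedEnergy θ S h) σ * Real.exp (c₀ * S.card) := by
          refine Finset.sum_le_sum fun σ _ => mul_le_mul_of_nonneg_left ?_ (gibbs_pos _ σ).le
          refine Real.exp_le_exp.2 (mul_le_mul (min_le_left _ _) ?_ (by positivity) hc₀.le)
          rw [div_le_iff₀ hk, ← sq]
          exact mag_sq_le S σ
      _ = _ := by rw [← Finset.sum_mul, sum_gibbs, one_mul]
  rw [sum_plantedProb_mul]
  have hint1 : Integrable (fun h : Fin n → ℝ => B.indicator (fun _ => Real.exp (c₀ * S.card)) h)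
      (Measure.pi fun _ => μ) := (integrable_const _).indicator hB
  have hint2 : Integrable (fun h : Fin n → ℝ => A * ∑ σ, gibbs (nullEnergy h) σ *
      Real.exp (1 / 2 / (2 * (S.card : ℝ)) * mag S σ ^ 2)) (Measure.pi fun _ => μ) :=
    (integrable_finsetSum _ fun σ _ => (integrable_gibbs_nullEnergy μ σ).mul_const _).const_mul A
  refine (integral_mono_of_nonneg (ae_of_all _ fun h => Finset.sum_nonneg fun σ _ =>
    mul_nonneg (gibbs_pos _ σ).le (Real.exp_pos _).le) (hint1.add hint2)
    (ae_of_all _ fun h => ?_)).trans ?_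
  · have hnn : 0 ≤ A * ∑ σ, gibbs (nullEnergy h) σ *
        Real.exp (1 / 2 / (2 * (S.card : ℝ)) * mag S σ ^ 2) :=
      mul_nonneg (by positivity) (Finset.sum_nonneg fun σ _ =>
        mul_nonneg (gibbs_pos _ σ).le (Real.exp_pos _).le)
    by_cases hh : h ∈ B
    · simp only [Pi.add_apply, Set.indicator_of_mem hh]
      linarith [hbad h]
    · simp only [Pi.add_apply, Set.indicator_of_notMem hh, zero_add]
      exact hgood h hh
  · rw [integral_add' hint1 hint2, integral_indicator_const _ hB, integral_const_mul,
      ← sum_nullProb_mul, smul_eq_mul]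
    simp_rw [nullProb_eq hμ]
    refine add_le_add ?_ (mul_le_mul_of_nonneg_left ?_ (by positivity))
    · refine (mul_le_mul_of_nonneg_right hBp (Real.exp_pos _).le).trans (le_of_eq ?_)
      rw [mul_assoc, ← Real.exp_add, neg_add_cancel, Real.exp_zero, mul_one]
    · refine (uniform_exp_mag_sq_le hS (by norm_num) (by norm_num)).trans (le_of_eq ?_)
      rw [show (2 : ℝ) / (1 - 1 / 2) = 2 ^ 2 by norm_num, Real.sqrt_sq (by norm_num)]

/-! ### Noise operator and hypercontractivity on the cube -/

section Noise

variable {n : ℕ}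

/-- The uniform average over the cube. -/
noncomputable def avg (f : Config n → ℝ) : ℝ := ((2 : ℝ) ^ n)⁻¹ * ∑ σ, f σ

/-- The kernel of the noise operator. -/
noncomputable def noiseKernel (ρ : ℝ) (σ τ : Config n) : ℝ :=
  ∏ i, (1 + ρ * (spin (σ i) * spin (τ i)))

/-- The noise operator. -/
noncomputable def noise (ρ : ℝ) (f : Config n → ℝ) (σ : Config n) : ℝ :=
  avg fun τ => noiseKernel ρ σ τ * f τ

/-- The Walsh character of the set `A`. -/
noncomputable def walsh (A : Finset (Fin n)) (σ : Config n) : ℝ := ∏ i ∈ A, spin (σ i)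

lemma avg_mono {f g : Config n → ℝ} (h : ∀ σ, f σ ≤ g σ) : avg f ≤ avg g :=
  mul_le_mul_of_nonneg_left (Finset.sum_le_sum fun σ _ => h σ) (by positivity)

lemma avg_nonneg {f : Config n → ℝ} (h : ∀ σ, 0 ≤ f σ) : 0 ≤ avg f :=
  mul_nonneg (by positivity) (Finset.sum_nonneg fun σ _ => h σ)

lemma avg_const_mul (c : ℝ) (f : Config n → ℝ) : avg (fun σ => c * f σ) = c * avg f := by
  unfold avg; rw [← Finset.mul_sum]; ring

lemma avg_add (f g : Config n → ℝ) : avg (fun σ => f σ + g σ) = avg f + avg g := by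
  unfold avg; rw [Finset.sum_add_distrib]; ring

lemma avg_comm {m : ℕ} (F : Config n → Config m → ℝ) :
    avg (fun σ => avg fun τ => F σ τ) = avg fun τ => avg fun σ => F σ τ := by
  unfold avg
  simp_rw [Finset.mul_sum]
  rw [Finset.sum_comm]
  exact Finset.sum_congr rfl fun _ _ => Finset.sum_congr rfl fun _ _ => by ring

lemma avg_prod (f : Fin n → ℤˣ → ℝ) :
    avg (fun σ => ∏ i, f i (σ i)) = ∏ i, ((f i 1 + f i (-1)) / 2) := by
  rw [avg, sum_config_prod, Finset.prod_div_distrib]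
  simp [div_eq_inv_mul]

lemma avg_succ (f : Config (n + 1) → ℝ) :
    avg f = avg fun σ : Config n => (f (Fin.cons 1 σ) + f (Fin.cons (-1) σ)) / 2 := by
  unfold avg
  rw [← (Fin.consEquiv fun _ : Fin (n + 1) => ℤˣ).sum_comp, Fintype.sum_prod_type, sum_units,
    ← Finset.sum_add_distrib, Finset.mul_sum, Finset.mul_sum]
  refine Finset.sum_congr rfl fun σ _ => ?_
  simp only [Fin.consEquiv, Equiv.coe_fn_mk]
  rw [pow_succ]
  field_simp

lemma noiseKernel_comm (ρ : ℝ) (σ τ : Config n) : noiseKernel ρ σ τ = noiseKernel ρ τ σ := by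
  unfold noiseKernel
  exact Finset.prod_congr rfl fun i _ => by rw [mul_comm (spin (σ i))]

lemma avg_noiseKernel_mul (ρ ρ' : ℝ) (τ η : Config n) :
    avg (fun σ => noiseKernel ρ σ τ * noiseKernel ρ' σ η) = noiseKernel (ρ * ρ') τ η := by
  unfold noiseKernel
  simp_rw [← Finset.prod_mul_distrib]
  rw [avg_prod (fun i s => (1 + ρ * (spin s * spin (τ i))) * (1 + ρ' * (spin s * spin (η i))))]
  refine Finset.prod_congr rfl fun i _ => ?_
  rw [spin_neg, spin_one]
  ring

lemma noiseKernel_eq_sum (ρ : ℝ) (σ τ : Config n) :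
    noiseKernel ρ σ τ = ∑ A : Finset (Fin n), ρ ^ A.card * (walsh A σ * walsh A τ) := by
  unfold noiseKernel walsh
  rw [Finset.prod_one_add, Finset.powerset_univ]
  refine Finset.sum_congr rfl fun A _ => ?_
  rw [Finset.prod_mul_distrib, Finset.prod_mul_distrib, Finset.prod_const]

lemma noiseKernel_one (σ τ : Config n) :
    noiseKernel 1 σ τ = if σ = τ then (2 : ℝ) ^ n else 0 := by
  unfold noiseKernel
  split_ifs with h
  · subst h
    simp_rw [spin_mul_self]
    norm_num
  · obtain ⟨i, hi⟩ := Function.ne_iff.1 h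
    refine Finset.prod_eq_zero (Finset.mem_univ i) ?_
    have : σ i = -τ i := by
      rcases Int.units_eq_one_or (σ i) with h1 | h1 <;>
        rcases Int.units_eq_one_or (τ i) with h2 | h2 <;> simp_all
    rw [this, spin_neg, neg_mul, spin_mul_self]
    norm_num

/-- Splitting `f` into its even and odd parts in the first coordinate makes noise act there as
multiplication of the odd part by `ρ`. This drives the induction on dimension. -/
lemma noise_cons (ρ : ℝ) (f : Config (n + 1) → ℝ) (s : ℤˣ) (σ : Config n) :
    noise ρ f (Fin.cons s σ) =
      noise ρ (fun τ => (f (Fin.cons 1 τ) + f (Fin.cons (-1) τ)) / 2) σ +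
        ρ * spin s * noise ρ (fun τ => (f (Fin.cons 1 τ) - f (Fin.cons (-1) τ)) / 2) σ := by
  unfold noise
  rw [avg_succ, ← avg_const_mul, ← avg_add]
  congr 1
  ext τ
  simp only [noiseKernel, Fin.prod_univ_succ, Fin.cons_zero, Fin.cons_succ, spin_neg, spin_one]
  ring

lemma sum_range_even (t : ℕ → ℝ) (j : ℕ) :
    ∑ m ∈ Finset.range (2 * j + 1), t m * ((1 + (-1) ^ m) / 2) =
      ∑ i ∈ Finset.range (j + 1), t (2 * i) := by
  induction j with
  | zero => simp
  | succ j ih =>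
    rw [show 2 * (j + 1) + 1 = 2 * j + 1 + 1 + 1 by ring, Finset.sum_range_succ,
      Finset.sum_range_succ, ih, Finset.sum_range_succ _ (j + 1)]
    have h1 : (-1 : ℝ) ^ (2 * j + 1) = -1 := by rw [pow_succ, pow_mul]; norm_num
    have h2 : (-1 : ℝ) ^ (2 * j + 1 + 1) = 1 := by rw [pow_succ, h1]; norm_num
    rw [h1, h2, show 2 * (j + 1) = 2 * j + 1 + 1 by ring]
    ring

/-- Odd terms of the binomial expansion cancel, and the remaining ones compare termwise: `ρ ^ (2 *
i) * (2j).choose (2i) ≤ 1 ≤ j.choose i`. The choice `ρ = 1 / (2j)` is not the sharp one but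
suffices. -/
lemma two_point_inequality {j : ℕ} (hj : 0 < j) (x y : ℝ) :
    ((x + 1 / (2 * j) * y) ^ (2 * j) + (x - 1 / (2 * j) * y) ^ (2 * j)) / 2 ≤
      (x ^ 2 + y ^ 2) ^ j := by
  set ρ : ℝ := 1 / (2 * j) with hρ
  have h1 : ((x + ρ * y) ^ (2 * j) + (x - ρ * y) ^ (2 * j)) / 2 =
      ∑ i ∈ Finset.range (j + 1),
        (ρ * y) ^ (2 * i) * x ^ (2 * j - 2 * i) * ((2 * j).choose (2 * i) : ℝ) := by
    rw [← sum_range_even fun m => (ρ * y) ^ m * x ^ (2 * j - m) * ((2 * j).choose m : ℝ),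
      add_comm x, add_pow, show x - ρ * y = -(ρ * y) + x by ring, add_pow,
      ← Finset.sum_add_distrib, Finset.sum_div]
    refine Finset.sum_congr rfl fun m _ => ?_
    rw [neg_pow (ρ * y) m]
    ring
  rw [h1, add_comm (x ^ 2), add_pow]
  refine Finset.sum_le_sum fun i hi => ?_
  have hij : i ≤ j := by simpa [Nat.lt_succ_iff] using hi
  have e1 : x ^ (2 * j - 2 * i) = (x ^ 2) ^ (j - i) := by
    rw [← pow_mul]; congr 1; omega
  have e2 : (ρ * y) ^ (2 * i) = ρ ^ (2 * i) * (y ^ 2) ^ i := by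
    rw [mul_pow, pow_mul y]
  rw [e1, e2]
  have h2 : ρ ^ (2 * i) * ((2 * j).choose (2 * i) : ℝ) ≤ (j.choose i : ℝ) := by
    have h3 : ((2 * j).choose (2 * i) : ℝ) ≤ (2 * j : ℝ) ^ (2 * i) := by
      exact_mod_cast Nat.choose_le_pow (2 * j) (2 * i)
    have h4 : (1 : ℝ) ≤ j.choose i := by exact_mod_cast Nat.choose_pos hij
    have hj' : (0 : ℝ) < j := by exact_mod_cast hj
    calc ρ ^ (2 * i) * ((2 * j).choose (2 * i) : ℝ) ≤ ρ ^ (2 * i) * (2 * j : ℝ) ^ (2 * i) := by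
          gcongr
      _ = 1 := by
          rw [← mul_pow, hρ, one_div, inv_mul_cancel₀ (by positivity), one_pow]
      _ ≤ _ := h4
  calc ρ ^ (2 * i) * (y ^ 2) ^ i * (x ^ 2) ^ (j - i) * ((2 * j).choose (2 * i) : ℝ)
      = ρ ^ (2 * i) * ((2 * j).choose (2 * i) : ℝ) * ((y ^ 2) ^ i * (x ^ 2) ^ (j - i)) := by ring
    _ ≤ (j.choose i : ℝ) * ((y ^ 2) ^ i * (x ^ 2) ^ (j - i)) := by gcongr
    _ = _ := by ring

/-- Minkowski's inequality in `L^j` of the uniform measure, written without roots. -/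
lemma avg_add_pow_le {j : ℕ} (hj : 0 < j) {A B : Config n → ℝ} (hA : ∀ σ, 0 ≤ A σ)
    (hB : ∀ σ, 0 ≤ B σ) {a b : ℝ} (ha : 0 ≤ a) (hb : 0 ≤ b)
    (hAa : avg (fun σ => A σ ^ j) ≤ a ^ j) (hBb : avg (fun σ => B σ ^ j) ≤ b ^ j) :
    avg (fun σ => (A σ + B σ) ^ j) ≤ (a + b) ^ j := by
  have hj1 : (1 : ℝ) ≤ j := by exact_mod_cast hj
  have hj0 : (j : ℝ) ≠ 0 := by positivity
  set N : ℝ := (2 : ℝ) ^ n with hN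
  have hN0 : 0 < N := by positivity
  have hroot : ∀ {A : Config n → ℝ} {a : ℝ}, (∀ σ, 0 ≤ A σ) → 0 ≤ a →
      avg (fun σ => A σ ^ j) ≤ a ^ j →
      (∑ σ, A σ ^ (j : ℝ)) ^ (1 / (j : ℝ)) ≤ N ^ (1 / (j : ℝ)) * a := by
    intro A a hA ha h
    simp_rw [Real.rpow_natCast]
    have h1 : ∑ σ, A σ ^ j ≤ N * a ^ j := by
      rw [avg, inv_mul_le_iff₀ hN0] at h; exact h
    refine (Real.rpow_le_rpow (Finset.sum_nonneg fun σ _ => pow_nonneg (hA σ) _) h1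
      (by positivity)).trans (le_of_eq ?_)
    rw [Real.mul_rpow hN0.le (by positivity), one_div, Real.pow_rpow_inv_natCast ha (by omega)]
  have h := Real.Lp_add_le_of_nonneg (s := Finset.univ) hj1 (fun σ _ => hA σ) (fun σ _ => hB σ)
  have h2 := h.trans (add_le_add (hroot hA ha hAa) (hroot hB hb hBb))
  rw [← mul_add] at h2
  have h3 := pow_le_pow_left₀ (Real.rpow_nonneg (Finset.sum_nonneg fun σ _ =>
    Real.rpow_nonneg (add_nonneg (hA σ) (hB σ)) _) _) h2 j
  rw [mul_pow, one_div, Real.rpow_inv_natCast_pow _ (by omega),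
    Real.rpow_inv_natCast_pow hN0.le (by omega)] at h3
  · simp_rw [Real.rpow_natCast] at h3
    rw [avg, inv_mul_le_iff₀ hN0]
    exact h3
  · exact Finset.sum_nonneg fun σ _ => Real.rpow_nonneg (add_nonneg (hA σ) (hB σ)) _

/-- Hypercontractivity from `L²` to `L^{2j}`. -/
lemma avg_noise_pow_le {j : ℕ} (hj : 0 < j) : ∀ {n : ℕ} (g : Config n → ℝ),
    avg (fun σ => noise (1 / (2 * j)) g σ ^ (2 * j)) ≤ avg (fun σ => g σ ^ 2) ^ j := by
  intro n
  induction n with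
  | zero =>
    intro g
    simp [avg, noise, noiseKernel, pow_mul]
  | succ n ih =>
    intro g
    set a : Config n → ℝ := fun τ => (g (Fin.cons 1 τ) + g (Fin.cons (-1) τ)) / 2
    set b : Config n → ℝ := fun τ => (g (Fin.cons 1 τ) - g (Fin.cons (-1) τ)) / 2
    have h1 : avg (fun σ => g σ ^ 2) = avg (fun σ => a σ ^ 2) + avg (fun σ => b σ ^ 2) := by
      rw [avg_succ, ← avg_add]
      congr 1
      ext σ
      simp only [a, b]
      ring
    rw [h1, avg_succ]
    refine le_trans (avg_mono fun σ => ?_) (avg_add_pow_le hj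
      (A := fun σ => noise (1 / (2 * j)) a σ ^ 2) (B := fun σ => noise (1 / (2 * j)) b σ ^ 2)
      (fun σ => sq_nonneg _) (fun σ => sq_nonneg _) (avg_nonneg fun σ => sq_nonneg _)
      (avg_nonneg fun σ => sq_nonneg _) ?_ ?_)
    · rw [noise_cons, noise_cons, spin_neg, spin_one]
      refine le_trans (le_of_eq ?_) (two_point_inequality hj _ _)
      ring
    · simp_rw [← pow_mul]; exact ih a
    · simp_rw [← pow_mul]; exact ih b

lemma avg_noise_sq_eq (ρ : ℝ) (f : Config n → ℝ) :
    avg (fun σ => noise ρ f σ ^ 2) = avg (fun σ => f σ * noise ρ (noise ρ f) σ) := by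
  have h1 : ∀ σ, noise ρ f σ ^ 2 = avg fun τ => f τ * (noiseKernel ρ τ σ * noise ρ f σ) := by
    intro σ
    rw [sq]
    conv_lhs => enter [1]; rw [noise]
    rw [mul_comm, ← avg_const_mul]
    congr 1; ext τ
    rw [noiseKernel_comm]; ring
  simp_rw [h1]
  rw [avg_comm]
  congr 1; ext τ
  rw [avg_const_mul]
  rfl

/-- Dual hypercontractivity, from `L^p` with `p = 2j / (2j - 1)` to `L²`. -/
lemma avg_noise_sq_le {j : ℕ} (hj : 0 < j) {f : Config n → ℝ} (hf : ∀ σ, 0 ≤ f σ) {p : ℝ}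
    (hp : p.HolderConjugate (2 * j : ℕ)) :
    avg (fun σ => noise (1 / (2 * j)) f σ ^ 2) ≤ avg (fun σ => f σ ^ p) ^ (2 / p) := by
  set ρ : ℝ := 1 / (2 * j)
  set g := noise ρ f
  set G := avg fun σ => g σ ^ 2 with hG
  set F := avg fun σ => f σ ^ p with hF
  have hG0 : 0 ≤ G := avg_nonneg fun σ => sq_nonneg _
  have hF0 : 0 ≤ F := avg_nonneg fun σ => Real.rpow_nonneg (hf σ) _
  have hN0 : (0 : ℝ) < ((2 : ℝ) ^ n)⁻¹ := by positivity
  set q : ℝ := ((2 * j : ℕ) : ℝ) with hq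
  have hq0 : 0 < q := by rw [hq]; positivity
  have hp0 : 0 < p := hp.pos
  -- Self-adjointness gives `G = ⟨f, T g⟩`. Hölder and hypercontractivity for `g = T f` bound this
  -- by `‖f‖_p * ‖g‖_2`, and one factor `√G` cancels.
  have h1 : G ≤ F ^ (1 / p) * √G := by
    have h2 := Real.inner_le_Lp_mul_Lq Finset.univ f (noise ρ g) hp
    have h3 := avg_noise_pow_le hj g
    have e1 : ∀ σ, |noise ρ g σ| ^ q = noise ρ g σ ^ (2 * j) := fun σ => by
      rw [hq, Real.rpow_natCast, pow_mul, sq_abs, pow_mul]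
    have e2 : ∀ σ, |f σ| ^ p = f σ ^ p := fun σ => by rw [abs_of_nonneg (hf σ)]
    simp_rw [e1, e2] at h2
    have h4 : avg (fun σ => noise ρ g σ ^ (2 * j)) ^ (1 / q) ≤ √G := by
      refine (Real.rpow_le_rpow (avg_nonneg fun σ => by rw [pow_mul]; positivity) h3
        (by positivity)).trans (le_of_eq ?_)
      rw [← Real.rpow_natCast, ← Real.rpow_mul hG0, Real.sqrt_eq_rpow]
      congr 1
      rw [hq]; push_cast
      have : (j : ℝ) ≠ 0 := by positivity
      field_simp
    calc G = avg fun σ => f σ * noise ρ g σ := avg_noise_sq_eq ρ f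
      _ ≤ ((2 : ℝ) ^ n)⁻¹ * ((∑ σ, f σ ^ p) ^ (1 / p) *
            (∑ σ, noise ρ g σ ^ (2 * j)) ^ (1 / q)) := mul_le_mul_of_nonneg_left h2 hN0.le
      _ = F ^ (1 / p) * avg (fun σ => noise ρ g σ ^ (2 * j)) ^ (1 / q) := by
          rw [hF, avg, avg, Real.mul_rpow hN0.le (Finset.sum_nonneg fun σ _ =>
            Real.rpow_nonneg (hf σ) _), Real.mul_rpow hN0.le (Finset.sum_nonneg fun σ _ => by
              rw [pow_mul]; positivity)]
          have : (((2 : ℝ) ^ n)⁻¹) ^ (1 / p) * (((2 : ℝ) ^ n)⁻¹) ^ (1 / q) =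
              ((2 : ℝ) ^ n)⁻¹ := by
            rw [← Real.rpow_add hN0, one_div, one_div, hp.inv_add_inv_eq_one, Real.rpow_one]
          linear_combination -((∑ σ, f σ ^ p) ^ (1 / p) *
            (∑ σ, noise ρ g σ ^ (2 * j)) ^ (1 / q)) * this
      _ ≤ F ^ (1 / p) * √G := by gcongr
  have h5 : √G ≤ F ^ (1 / p) := by
    rcases hG0.eq_or_lt with h0 | h0
    · rw [← h0, Real.sqrt_zero]; positivity
    · have h6 := Real.sqrt_pos.2 h0
      refine le_of_mul_le_mul_right ?_ h6
      rwa [Real.mul_self_sqrt hG0]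
  calc G = √G ^ 2 := (Real.sq_sqrt hG0).symm
    _ ≤ (F ^ (1 / p)) ^ 2 := by gcongr
    _ = F ^ (2 / p) := by
        rw [← Real.rpow_natCast, ← Real.rpow_mul hF0]
        congr 1; push_cast; ring

/-! ### Walsh coefficients -/

/-- The Walsh coefficient of a weight function on the cube. -/
noncomputable def coef (P : Config n → ℝ) (A : Finset (Fin n)) : ℝ := ∑ σ, P σ * walsh A σ

lemma sum_noiseKernel_mul_mul (ρ : ℝ) (P P' : Config n → ℝ) :
    ∑ σ, ∑ τ, noiseKernel ρ σ τ * (P σ * P' τ) =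
      ∑ A, ρ ^ A.card * (coef P A * coef P' A) := by
  have h1 : ∀ σ, ∑ τ, noiseKernel ρ σ τ * (P σ * P' τ) =
      ∑ A, ∑ τ, ρ ^ A.card * (P σ * walsh A σ * (P' τ * walsh A τ)) := fun σ => by
    rw [Finset.sum_comm]
    refine Finset.sum_congr rfl fun τ _ => ?_
    rw [noiseKernel_eq_sum, Finset.sum_mul]
    exact Finset.sum_congr rfl fun A _ => by ring
  simp_rw [h1]
  rw [Finset.sum_comm]
  refine Finset.sum_congr rfl fun A _ => ?_
  rw [coef, coef, Finset.sum_mul_sum, Finset.mul_sum]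
  simp_rw [Finset.mul_sum]

/-- At `ρ = 1` the noise kernel is `2 ^ n` times the identity. -/
lemma parseval (P P' : Config n → ℝ) :
    (2 : ℝ) ^ n * ∑ σ, P σ * P' σ = ∑ A, coef P A * coef P' A := by
  have := sum_noiseKernel_mul_mul 1 P P'
  simp_rw [noiseKernel_one, one_pow, one_mul] at this
  rw [← this, Finset.mul_sum]
  simp [ite_mul]

/-- Two noise steps of correlation `ρ` compose to one of correlation `ρ * ρ`. -/
lemma sum_pow_mul_coef_sq (ρ : ℝ) (P : Config n → ℝ) :
    ∑ A, (ρ * ρ) ^ A.card * coef P A ^ 2 =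
      avg (fun σ => noise ρ (fun τ => (2 : ℝ) ^ n * P τ) σ ^ 2) := by
  have h1 : ∀ σ, noise ρ (fun τ => (2 : ℝ) ^ n * P τ) σ = ∑ τ, noiseKernel ρ σ τ * P τ := by
    intro σ
    rw [noise, avg, Finset.mul_sum]
    refine Finset.sum_congr rfl fun τ _ => ?_
    field_simp
  have h2 : ∀ σ, (∑ τ, noiseKernel ρ σ τ * P τ) ^ 2 =
      ∑ τ, ∑ η, noiseKernel ρ σ τ * noiseKernel ρ σ η * (P τ * P η) := fun σ => by
    rw [sq, Finset.sum_mul_sum]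
    exact Finset.sum_congr rfl fun τ _ => Finset.sum_congr rfl fun η _ => by ring
  simp_rw [h1, h2, sq (coef _ _)]
  have h3 : ∀ τ η, noiseKernel (ρ * ρ) τ η * (P τ * P η) =
      ∑ σ, ((2 : ℝ) ^ n)⁻¹ * (noiseKernel ρ σ τ * noiseKernel ρ σ η * (P τ * P η)) := by
    intro τ η
    rw [← avg_noiseKernel_mul, avg, ← Finset.mul_sum, ← Finset.sum_mul, mul_assoc]
  rw [← sum_noiseKernel_mul_mul, avg]
  simp_rw [h3, Finset.mul_sum]
  symm
  exact Finset.sum_comm.trans (Finset.sum_congr rfl fun τ _ => Finset.sum_comm)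

end Noise

/-! ### Walsh coefficients of the planted law -/

section Coef

variable {n : ℕ}

lemma walsh_mul (A : Finset (Fin n)) (σ τ : Config n) :
    walsh A (σ * τ) = walsh A σ * walsh A τ := by
  unfold walsh
  rw [← Finset.prod_mul_distrib]
  exact Finset.prod_congr rfl fun i _ => spin_mul _ _

lemma coef_eq_zero {P : Config n → ℝ} {A : Finset (Fin n)} (ε : Config n)
    (hP : ∀ σ, P (ε * σ) = P σ) (hε : walsh A ε = -1) : coef P A = 0 := by
  have h : coef P A = -coef P A := by
    have := Equiv.sum_comp (Equiv.mulLeft ε) fun σ => P σ * walsh A σ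
    simp only [Equiv.coe_mulLeft, hP, walsh_mul, hε] at this
    simp only [neg_one_mul, mul_neg, Finset.sum_neg_distrib] at this
    exact this.symm
  linarith

variable {μ : Measure ℝ} [IsProbabilityMeasure μ]

lemma coef_plantedProb_empty (θ : ℝ) (S : Finset (Fin n)) :
    coef (plantedProb μ θ S) ∅ = 1 := by
  simp [coef, walsh, sum_plantedProb]

lemma coef_plantedProb_of_not_subset (hμ : μ.map (fun h : ℝ => -h) = μ) (θ : ℝ)
    {S A : Finset (Fin n)} (hA : ¬A ⊆ S) : coef (plantedProb μ θ S) A = 0 := by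
  obtain ⟨i, hiA, hiS⟩ := Finset.not_subset.1 hA
  refine coef_eq_zero (Pi.mulSingle i (-1)) (fun σ =>
    plantedProb_mul_left hμ θ S _ σ fun τ => ?_) ?_
  · congr 1
    refine Finset.sum_congr rfl fun j hj => ?_
    have : j ≠ i := fun h => hiS (h ▸ hj)
    rw [Pi.mul_apply, Pi.mulSingle_eq_of_ne this, one_mul]
  · rw [walsh, ← Finset.mul_prod_erase _ _ hiA, Pi.mulSingle_eq_same, spin_neg, spin_one,
      Finset.prod_eq_one, mul_one]
    intro j hj
    rw [Pi.mulSingle_eq_of_ne (Finset.ne_of_mem_erase hj), spin_one]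

/-- The global flip preserves the squared magnetization and reverses odd characters. The loss of the
linear term is what makes the overlap bound quadratic. -/
lemma coef_plantedProb_of_card_eq_one (hμ : μ.map (fun h : ℝ => -h) = μ) (θ : ℝ)
    (S : Finset (Fin n)) {A : Finset (Fin n)} (hA : A.card = 1) :
    coef (plantedProb μ θ S) A = 0 := by
  refine coef_eq_zero (fun _ => -1) (fun σ => plantedProb_mul_left hμ θ S _ σ fun τ => ?_) ?_
  · unfold mag
    simp_rw [Pi.mul_apply, neg_one_mul, spin_neg, Finset.sum_neg_distrib, neg_sq]
  · rw [walsh, Finset.prod_const, hA, spin_neg, spin_one, pow_one]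

lemma coef_plantedProb_map (θ : ℝ) (S A : Finset (Fin n)) (π : Equiv.Perm (Fin n)) :
    coef (plantedProb μ θ (S.map π.toEmbedding)) (A.map π.toEmbedding) =
      coef (plantedProb μ θ S) A := by
  unfold coef
  rw [← (Equiv.arrowCongr π (Equiv.refl ℤˣ)).sum_comp]
  refine Finset.sum_congr rfl fun σ _ => ?_
  rw [plantedProb_perm, walsh, Finset.prod_map, walsh]
  have : (Equiv.arrowCongr π (Equiv.refl ℤˣ)) σ ∘ π = σ := by
    ext i; simp [Equiv.arrowCongr]
  rw [this]
  congr 1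
  exact Finset.prod_congr rfl fun i _ => by simp [Equiv.arrowCongr]

/-- The cells cut out by membership in `S` and in `A` have the same sizes as those of `S'` and `A'`,
so bijections between cells glue to a permutation. -/
lemma exists_perm_map_eq {S S' A A' : Finset (Fin n)} (hA : A ⊆ S) (hA' : A' ⊆ S')
    (hS : S.card = S'.card) (hAc : A.card = A'.card) :
    ∃ π : Equiv.Perm (Fin n), S.map π.toEmbedding = S' ∧ A.map π.toEmbedding = A' := by
  have hcard : ∀ c : Prop × Prop,
      Nonempty ({i // (i ∈ S, i ∈ A) = c} ≃ {i // (i ∈ S', i ∈ A') = c}) := by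
    classical
    rintro ⟨c1, c2⟩
    refine ⟨Fintype.equivOfCardEq ?_⟩
    rw [Fintype.card_subtype, Fintype.card_subtype]
    simp only [Prod.mk.injEq, eq_iff_iff]
    by_cases h1 : c1 <;> by_cases h2 : c2 <;> simp only [h1, h2, iff_true, iff_false]
    · have e : ∀ {S A : Finset (Fin n)}, A ⊆ S →
          (Finset.univ.filter fun i => i ∈ S ∧ i ∈ A) = A := fun h => by
        ext i; simpa using fun hi => h hi
      rw [e hA, e hA', hAc]
    · have e : ∀ {S A : Finset (Fin n)},
          (Finset.univ.filter fun i => i ∈ S ∧ i ∉ A) = S \ A := by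
        intros; ext i; simp
      rw [e, e, Finset.card_sdiff_of_subset hA, Finset.card_sdiff_of_subset hA', hS, hAc]
    · have e : ∀ {S A : Finset (Fin n)}, A ⊆ S →
          (Finset.univ.filter fun i => i ∉ S ∧ i ∈ A) = ∅ := fun h => by
        ext i; simpa using fun hi hi' => hi (h hi')
      rw [e hA, e hA']
    · have e : ∀ {S A : Finset (Fin n)}, A ⊆ S →
          (Finset.univ.filter fun i => i ∉ S ∧ i ∉ A) = Sᶜ := fun h => by
        ext i; simpa using fun hi hi' => hi (h hi')
      rw [e hA, e hA', Finset.card_compl, Finset.card_compl, hS]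
  have e := fun c => (hcard c).some
  refine ⟨Equiv.ofFiberEquiv (f := fun i => (i ∈ S, i ∈ A)) (g := fun i => (i ∈ S', i ∈ A'))
    fun c => e c, ?_, ?_⟩
  all_goals
    set π : Equiv.Perm (Fin n) := Equiv.ofFiberEquiv (f := fun i => (i ∈ S, i ∈ A))
      (g := fun i => (i ∈ S', i ∈ A')) fun c => e c with hπ
    have hmem : ∀ i, (π i ∈ S', π i ∈ A') = (i ∈ S, i ∈ A) := fun i =>
      Equiv.ofFiberEquiv_map (fun c => e c) i
    simp only [Prod.mk.injEq, eq_iff_iff] at hmem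
    ext j
    rw [Finset.mem_map_equiv]
    have := hmem (π.symm j)
    rw [Equiv.apply_symm_apply] at this
    tauto

lemma coef_plantedProb_eq (θ : ℝ) {S S' A A' : Finset (Fin n)} (hA : A ⊆ S) (hA' : A' ⊆ S')
    (hS : S.card = S'.card) (hAc : A.card = A'.card) :
    coef (plantedProb μ θ S) A = coef (plantedProb μ θ S') A' := by
  obtain ⟨π, rfl, rfl⟩ := exists_perm_map_eq hA hA' hS hAc
  rw [coef_plantedProb_map]

lemma plantedProb_le (hμ : μ.map (fun h : ℝ => -h) = μ) {θ : ℝ} (hθ : 0 ≤ θ)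
    (S : Finset (Fin n)) (σ : Config n) :
    plantedProb μ θ S σ ≤
      ((2 : ℝ) ^ n)⁻¹ * Real.exp (θ / (2 * (S.card : ℝ)) * mag S σ ^ 2) := by
  rw [← nullProb_eq hμ σ, nullProb, ← integral_mul_const]
  exact integral_mono (integrable_gibbs_plantedEnergy μ θ S σ)
    ((integrable_gibbs_nullEnergy μ σ).mul_const _) fun h => gibbs_plantedEnergy_le hθ S h σ

end Coef

/-- At high temperature, the planted likelihood ratio has bounded noise stability for some
positive correlation. -/
theorem exists_noise_bound {μ : Measure ℝ} [IsProbabilityMeasure μ]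
    (hμ : μ.map (fun h : ℝ => -h) = μ) {θ : ℝ} (hθ : HighTemperature μ θ) :
    ∃ ρ > 0, ∃ C, ∀ (n : ℕ) (S : Finset (Fin n)), S.Nonempty →
      ∑ A, ρ ^ A.card * coef (plantedProb μ θ S) A ^ 2 ≤ C := by
  obtain ⟨c, hc, C, H⟩ := exists_exp_moment hμ hθ
  have hθ0 := hθ.1
  -- Here `p - 1 = 1 / (2j - 1)`, and `j > θ / c` ensures `θ * (p - 1) / 2 ≤ c`, within reach of the
  -- Gaussian moment.
  obtain ⟨j, hj⟩ := exists_nat_gt (max 1 (θ / c))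
  have hj1 : (1 : ℝ) < j := (le_max_left _ _).trans_lt hj
  have hjc : θ / c < j := (le_max_right _ _).trans_lt hj
  have hj0 : 0 < j := by exact_mod_cast one_pos.trans hj1
  set q : ℝ := ((2 * j : ℕ) : ℝ) with hq
  have hqj : q = 2 * j := by rw [hq]; push_cast; ring
  have hpq : (q / (q - 1)).HolderConjugate ((2 * j : ℕ) : ℝ) :=
    (Real.HolderConjugate.conjExponent (by rw [hqj]; linarith)).symm
  set p := q / (q - 1) with hp
  have hp1 : p - 1 = 1 / (q - 1) := by
    have : q - 1 ≠ 0 := by rw [hqj]; linarith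
    rw [hp]; field_simp; ring
  have hp0 : 0 < p := hpq.pos
  refine ⟨1 / (2 * j) * (1 / (2 * j)), by positivity, C ^ (2 / p), fun n S hS => ?_⟩
  rw [sum_pow_mul_coef_sq]
  have hN : (0 : ℝ) < 2 ^ n := by positivity
  refine (avg_noise_sq_le hj0 (fun τ => mul_nonneg hN.le (plantedProb_nonneg μ θ S τ)) hpq).trans
    (Real.rpow_le_rpow (avg_nonneg fun σ => Real.rpow_nonneg
      (mul_nonneg hN.le (plantedProb_nonneg μ θ S σ)) _) (le_trans ?_ (H n S hS)) (by positivity))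
  rw [avg, Finset.mul_sum]
  refine Finset.sum_le_sum fun σ _ => ?_
  have h0 := plantedProb_nonneg μ θ S σ
  have hpm : 0 < p - 1 := by
    rw [hp1]; exact one_div_pos.2 (by rw [hqj]; linarith)
  -- One factor of the likelihood ratio changes the uniform measure into the planted law, leaving a
  -- planted moment of its power `p - 1`.
  rw [show p = 1 + (p - 1) by ring, Real.rpow_add_of_nonneg (by positivity) one_pos.le hpm.le,
    Real.rpow_one, ← mul_assoc, inv_mul_cancel_left₀ hN.ne']
  refine mul_le_mul_of_nonneg_left ?_ h0
  have h1 : (2 : ℝ) ^ n * plantedProb μ θ S σ ≤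
      Real.exp (θ / (2 * (S.card : ℝ)) * mag S σ ^ 2) := by
    have := mul_le_mul_of_nonneg_left (plantedProb_le hμ hθ0.le S σ) hN.le
    rwa [mul_inv_cancel_left₀ hN.ne'] at this
  refine (Real.rpow_le_rpow (by positivity) h1 hpm.le).trans ?_
  rw [← Real.exp_mul]
  refine Real.exp_le_exp.2 ?_
  have h2 : θ * (p - 1) / 2 ≤ c := by
    rw [hp1, hqj]
    rw [div_lt_iff₀ hc] at hjc
    rw [mul_one_div, div_div, div_le_iff₀ (by linarith)]
    nlinarith
  have h3 : 0 ≤ mag S σ ^ 2 / (S.card : ℝ) := by positivity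
  calc θ / (2 * (S.card : ℝ)) * mag S σ ^ 2 * (p - 1)
      = θ * (p - 1) / 2 * (mag S σ ^ 2 / S.card) := by field_simp
    _ ≤ _ := mul_le_mul_of_nonneg_right h2 h3

/-! ### Correlation of two planted likelihood ratios -/

lemma descFactorial_mul_pow_le {r k : ℕ} (hrk : r ≤ k) (a : ℕ) :
    r.descFactorial a * k ^ a ≤ r ^ a * k.descFactorial a := by
  induction a with
  | zero => simp
  | succ a ih =>
    rw [Nat.descFactorial_succ, Nat.descFactorial_succ, pow_succ, pow_succ]
    have h : (r - a) * k ≤ r * (k - a) := by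
      rw [Nat.sub_mul, Nat.mul_sub]
      have : r * a ≤ a * k := by rw [mul_comm]; exact Nat.mul_le_mul_left a hrk
      omega
    calc (r - a) * r.descFactorial a * (k ^ a * k)
        = (r - a) * k * (r.descFactorial a * k ^ a) := by ring
      _ ≤ r * (k - a) * (r ^ a * k.descFactorial a) := Nat.mul_le_mul h ih
      _ = _ := by ring

/-- Each factor `(r - i) / (k - i)` of the ratio of falling factorials is at most `r / k`. -/
lemma choose_le_pow_mul_choose {r k : ℕ} (hrk : r ≤ k) (hk : 0 < k) (a : ℕ) :
    (r.choose a : ℝ) ≤ (r / k : ℝ) ^ a * k.choose a := by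
  have h := descFactorial_mul_pow_le hrk a
  rw [Nat.descFactorial_eq_factorial_mul_choose, Nat.descFactorial_eq_factorial_mul_choose] at h
  have h2 : r.choose a * k ^ a ≤ r ^ a * k.choose a := by
    refine Nat.le_of_mul_le_mul_left ?_ a.factorial_pos
    linarith
  have h3 : (r.choose a : ℝ) * (k : ℝ) ^ a ≤ (r : ℝ) ^ a * k.choose a := by exact_mod_cast h2
  rw [div_pow, div_mul_eq_mul_div, le_div_iff₀ (by positivity)]
  exact h3

/-- Two planted likelihood ratios whose cliques overlap in a small fraction are nearly
uncorrelated. -/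
theorem exists_overlap_bound {μ : Measure ℝ} [IsProbabilityMeasure μ]
    (hμ : μ.map (fun h : ℝ => -h) = μ) {θ : ℝ} (hθ : HighTemperature μ θ) :
    ∃ ρ > 0, ∃ C ≥ 0, ∀ (n k : ℕ) (S S' : Finset (Fin n)), 0 < k → S.card = k → S'.card = k →
      ((S ∩ S').card : ℝ) ≤ ρ * k →
      (2 : ℝ) ^ n * ∑ σ, plantedProb μ θ S σ * plantedProb μ θ S' σ ≤
        1 + C * ((S ∩ S').card / k : ℝ) ^ 2 := by
  obtain ⟨ρ, hρ, C, H⟩ := exists_noise_bound hμ hθ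
  refine ⟨ρ, hρ, max C 0 / ρ ^ 2, by positivity, fun n k S S' hk hS hS' hr => ?_⟩
  classical
  have hk' : (0 : ℝ) < k := by exact_mod_cast hk
  set R := S ∩ S' with hR
  have hRS : R ⊆ S := Finset.inter_subset_left
  have hRS' : R ⊆ S' := Finset.inter_subset_right
  have hrk : R.card ≤ k := hS ▸ Finset.card_le_card hRS
  -- By permutation symmetry the squared coefficient depends only on `|A|`. Sizes exceeding `|S|`
  -- receive the default `0`.
  obtain ⟨w, hw0, hw⟩ : ∃ w : ℕ → ℝ, (∀ a, 0 ≤ w a) ∧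
      ∀ A ⊆ S, coef (plantedProb μ θ S) A ^ 2 = w A.card := by
    refine ⟨fun a => if h : ∃ A ⊆ S, A.card = a then coef (plantedProb μ θ S) h.choose ^ 2 else 0,
      fun a => ?_, fun A hA => ?_⟩
    · dsimp only
      split_ifs <;> positivity
    · have h : ∃ B ⊆ S, B.card = A.card := ⟨A, hA, rfl⟩
      simp only
      rw [dif_pos h, coef_plantedProb_eq θ hA h.choose_spec.1 rfl h.choose_spec.2.symm]
  have hsum : ∀ {T : Finset (Fin n)}, T ⊆ S → ∀ f : ℕ → ℝ,
      ∑ A ∈ T.powerset, f A.card * coef (plantedProb μ θ S) A ^ 2 =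
        ∑ a ∈ Finset.range (T.card + 1), (T.card.choose a : ℝ) * (f a * w a) := by
    intro T hT f
    have := Finset.sum_powerset_apply_card (fun a => f a * w a) (x := T)
    simp only [nsmul_eq_mul] at this
    rw [← this]
    refine Finset.sum_congr rfl fun A hA => ?_
    rw [hw A ((Finset.mem_powerset.1 hA).trans hT)]
  have h1 : (2 : ℝ) ^ n * ∑ σ, plantedProb μ θ S σ * plantedProb μ θ S' σ =
      ∑ a ∈ Finset.range (R.card + 1), (R.card.choose a : ℝ) * w a := by
    have := hsum hRS fun _ => 1
    simp only [one_mul] at this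
    rw [parseval, ← this]
    symm
    rw [← Finset.sum_subset (Finset.subset_univ R.powerset)]
    · refine Finset.sum_congr rfl fun A hA => ?_
      have hA := Finset.mem_powerset.1 hA
      rw [sq, coef_plantedProb_eq θ (hA.trans hRS') (hA.trans hRS) (hS'.trans hS.symm) rfl]
    · intro A _ hA
      rw [Finset.mem_powerset, hR, Finset.subset_inter_iff, not_and_or] at hA
      rcases hA with hA | hA
      · rw [coef_plantedProb_of_not_subset hμ θ hA, zero_mul]
      · rw [coef_plantedProb_of_not_subset hμ θ hA, mul_zero]
  have h2 : ∑ a ∈ Finset.range (k + 1), (k.choose a : ℝ) * (ρ ^ a * w a) ≤ max C 0 := by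
    rw [← hS, ← hsum Finset.Subset.rfl fun a => ρ ^ a]
    refine le_trans (Finset.sum_le_sum_of_subset_of_nonneg (Finset.subset_univ _)
      fun A _ _ => by positivity) ((H n S (Finset.card_pos.1 (hS ▸ hk))).trans (le_max_left _ _))
  have hw_zero : w 0 = 1 := by
    rw [← Finset.card_empty (α := Fin n), ← hw ∅ (Finset.empty_subset _), coef_plantedProb_empty,
      one_pow]
  have hw_one : w 1 = 0 := by
    obtain ⟨i, hi⟩ := Finset.card_pos.1 (hS ▸ hk)
    rw [← Finset.card_singleton i, ← hw {i} (by simpa using hi),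
      coef_plantedProb_of_card_eq_one hμ θ S (Finset.card_singleton i), zero_pow two_ne_zero]
  set x : ℝ := R.card / k with hx
  have hx0 : 0 ≤ x := by positivity
  have hxρ : x ≤ ρ := by rw [hx, div_le_iff₀ hk']; exact hr
  -- The singleton term vanishes. For sizes at least two, `x ≤ ρ` allows `x ^ a ≤ (x / ρ) ^ 2 * ρ ^
  -- a`, reducing to the noise-weighted sum.
  have h3 : ∀ a, (R.card.choose (a + 1) : ℝ) * w (a + 1) ≤
      x ^ 2 / ρ ^ 2 * ((k.choose (a + 1) : ℝ) * (ρ ^ (a + 1) * w (a + 1))) := by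
    intro a
    rcases a with _ | a
    · simp [hw_one]
    · have h4 := choose_le_pow_mul_choose hrk hk (a + 1 + 1)
      have h5 : x ^ (a + 1 + 1) ≤ x ^ 2 / ρ ^ 2 * ρ ^ (a + 1 + 1) := by
        rw [show x ^ 2 / ρ ^ 2 * ρ ^ (a + 1 + 1) = x ^ 2 * ρ ^ a by
          field_simp; ring, show x ^ (a + 1 + 1) = x ^ 2 * x ^ a by ring]
        gcongr
      calc (R.card.choose (a + 1 + 1) : ℝ) * w (a + 1 + 1)
          ≤ (x ^ (a + 1 + 1) * k.choose (a + 1 + 1)) * w (a + 1 + 1) := by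
            gcongr; exact hw0 _
        _ ≤ (x ^ 2 / ρ ^ 2 * ρ ^ (a + 1 + 1) * k.choose (a + 1 + 1)) * w (a + 1 + 1) := by
            gcongr; exact hw0 _
        _ = _ := by ring
  rw [h1, Finset.sum_range_succ', Nat.choose_zero_right, hw_zero, Nat.cast_one, mul_one, add_comm]
  gcongr
  calc ∑ a ∈ Finset.range R.card, (R.card.choose (a + 1) : ℝ) * w (a + 1)
      ≤ ∑ a ∈ Finset.range R.card,
          x ^ 2 / ρ ^ 2 * ((k.choose (a + 1) : ℝ) * (ρ ^ (a + 1) * w (a + 1))) :=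
        Finset.sum_le_sum fun a _ => h3 a
    _ ≤ ∑ a ∈ Finset.range k,
          x ^ 2 / ρ ^ 2 * ((k.choose (a + 1) : ℝ) * (ρ ^ (a + 1) * w (a + 1))) :=
        Finset.sum_le_sum_of_subset_of_nonneg (Finset.range_mono hrk) fun a _ _ => by
          have := hw0 (a + 1); positivity
    _ ≤ x ^ 2 / ρ ^ 2 * ∑ a ∈ Finset.range (k + 1), (k.choose a : ℝ) * (ρ ^ a * w a) := by
        rw [← Finset.mul_sum, Finset.sum_range_succ']
        gcongr
        have := hw0 0
        exact le_add_of_nonneg_right (by positivity)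
    _ ≤ x ^ 2 / ρ ^ 2 * max C 0 := by gcongr
    _ = _ := by ring

/-! ### Overlap of random cliques -/

/-- A uniform `k`-subset contains a given `a`-subset with probability at most `(k / n) ^ a`, as if
sites were chosen independently. -/
lemma choose_sub_le {n k a : ℕ} (hak : a ≤ k) (hkn : k ≤ n) (hn : 0 < n) :
    ((n - a).choose (k - a) : ℝ) ≤ (k / n : ℝ) ^ a * n.choose k := by
  have h1 : (n.choose k : ℝ) * k.choose a = n.choose a * (n - a).choose (k - a) := by
    exact_mod_cast Nat.choose_mul hak
  have h2 := choose_le_pow_mul_choose hkn hn a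
  have h3 : (0 : ℝ) < n.choose a := by exact_mod_cast Nat.choose_pos (hak.trans hkn)
  refine le_of_mul_le_mul_left ?_ h3
  rw [← h1]
  calc (n.choose k : ℝ) * k.choose a ≤ n.choose k * ((k / n : ℝ) ^ a * n.choose a) := by gcongr
    _ = _ := by ring

lemma card_supersets_le {n k : ℕ} (A : Finset (Fin n)) :
    ((Finset.powersetCard k (Finset.univ : Finset (Fin n))).filter (A ⊆ ·)).card ≤
      (n - A.card).choose (k - A.card) := by
  have h : (Finset.powersetCard (k - A.card) Aᶜ).card = (n - A.card).choose (k - A.card) := by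
    rw [Finset.card_powersetCard, Finset.card_compl, Fintype.card_fin]
  rw [← h]
  refine Finset.card_le_card_of_injOn (fun T => T \ A) (fun T hT => ?_) fun T hT T' hT' hTT => ?_
  · simp only [Finset.coe_filter, Finset.mem_powersetCard, Set.mem_ofPred_eq] at hT
    rw [Finset.mem_coe, Finset.mem_powersetCard, Finset.card_sdiff_of_subset hT.2, hT.1.2]
    refine ⟨fun i hi => ?_, rfl⟩
    rw [Finset.mem_compl]
    exact (Finset.mem_sdiff.1 hi).2
  · simp only [Finset.coe_filter, Set.mem_ofPred_eq] at hT hT'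
    dsimp only at hTT
    rw [← Finset.sdiff_union_of_subset hT.2, hTT, Finset.sdiff_union_of_subset hT'.2]

/-- The generating function of the overlap of a fixed clique with a uniform one is at most
that of a Poisson variable of parameter `k² / n`. -/
lemma sum_one_add_pow_overlap_le {n k : ℕ} (hk : 0 < k) {S : Finset (Fin n)} (hS : S.card = k)
    {z : ℝ} (hz : 0 ≤ z) :
    ∑ S' ∈ Finset.powersetCard k (Finset.univ : Finset (Fin n)), (1 + z) ^ (S ∩ S').card ≤
      n.choose k * Real.exp (z * ((k : ℝ) ^ 2 / n)) := by
  have hkn : k ≤ n := by simpa [hS] using Finset.card_le_univ S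
  have hn : 0 < n := hk.trans_le hkn
  have h1 : ∀ S' : Finset (Fin n), (1 + z) ^ (S ∩ S').card =
      ∑ A ∈ S.powerset, if A ⊆ S' then z ^ A.card else 0 := fun S' => by
    rw [add_comm, ← Finset.sum_pow_mul_eq_add_pow, ← Finset.sum_filter]
    simp only [one_pow, mul_one]
    refine Finset.sum_congr ?_ fun _ _ => rfl
    ext A
    rw [Finset.mem_filter, Finset.mem_powerset, Finset.mem_powerset, Finset.subset_inter_iff]
  simp_rw [h1]
  rw [Finset.sum_comm]
  calc ∑ A ∈ S.powerset, ∑ S' ∈ Finset.powersetCard k (Finset.univ : Finset (Fin n)),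
        (if A ⊆ S' then z ^ A.card else 0)
      ≤ ∑ A ∈ S.powerset, (z * (k / n)) ^ A.card * n.choose k := by
        refine Finset.sum_le_sum fun A hA => ?_
        have hA := Finset.mem_powerset.1 hA
        have hAk : A.card ≤ k := hS ▸ Finset.card_le_card hA
        rw [← Finset.sum_filter, Finset.sum_const, nsmul_eq_mul, mul_pow]
        have h2 : (((Finset.powersetCard k (Finset.univ : Finset (Fin n))).filter
            (A ⊆ ·)).card : ℝ) ≤ (k / n : ℝ) ^ A.card * n.choose k :=
          le_trans (by exact_mod_cast card_supersets_le A) (choose_sub_le hAk hkn hn)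
        calc _ ≤ ((k / n : ℝ) ^ A.card * n.choose k) * z ^ A.card := by gcongr
          _ = _ := by ring
    _ = (z * (k / n) + 1) ^ k * n.choose k := by
        rw [← Finset.sum_mul, ← hS, ← Finset.sum_pow_mul_eq_add_pow]
        simp
    _ ≤ Real.exp (z * (k / n)) ^ k * n.choose k := by
        gcongr
        exact Real.add_one_le_exp _
    _ = _ := by
        rw [← Real.exp_nat_mul, mul_comm]
        congr 2
        ring

/-- Chernoff's bound from the generating function, with `1 + z` weakened to `z` in the logarithm. -/
lemma card_overlap_ge_le {n k : ℕ} (hk : 0 < k) {S : Finset (Fin n)} (hS : S.card = k)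
    {z u : ℝ} (hz : 0 < z) (hu : 0 ≤ u) :
    (((Finset.powersetCard k (Finset.univ : Finset (Fin n))).filter
      fun S' => u ≤ ((S ∩ S').card : ℝ)).card : ℝ) ≤
      n.choose k * Real.exp (z * ((k : ℝ) ^ 2 / n) - u * Real.log z) := by
  have h1 := sum_one_add_pow_overlap_le hk hS hz.le
  have h2 : (((Finset.powersetCard k (Finset.univ : Finset (Fin n))).filter
      fun S' => u ≤ ((S ∩ S').card : ℝ)).card : ℝ) * Real.exp (u * Real.log z) ≤
      ∑ S' ∈ Finset.powersetCard k (Finset.univ : Finset (Fin n)), (1 + z) ^ (S ∩ S').card := by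
    rw [← nsmul_eq_mul, ← Finset.sum_const]
    refine le_trans (Finset.sum_le_sum fun S' hS' => ?_)
      (Finset.sum_le_sum_of_subset_of_nonneg (Finset.filter_subset _ _)
        fun _ _ _ => by positivity)
    have hr := (Finset.mem_filter.1 hS').2
    calc Real.exp (u * Real.log z) ≤ Real.exp ((S ∩ S').card * Real.log (1 + z)) := by
          refine Real.exp_le_exp.2 ?_
          have h3 : Real.log z ≤ Real.log (1 + z) := Real.log_le_log hz (by linarith)
          have h4 : 0 ≤ Real.log (1 + z) := Real.log_nonneg (by linarith)
          nlinarith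
      _ = (1 + z) ^ (S ∩ S').card := by
          rw [Real.exp_nat_mul, Real.exp_log (by linarith)]
  rw [Real.exp_sub, ← mul_div_assoc, le_div_iff₀ (Real.exp_pos _)]
  exact h2.trans h1

/-- Chernoff with `z = t / lam` gives overlap `t` weight at most `exp (t - t log (t / lam))`. Half
of the logarithm pays for `α t²`; the other half exceeds `½ log B` and leaves `q ^ t`, a geometric
series. -/
lemma sum_le_of_overlap_small {n k : ℕ} (hk : 0 < k) {S : Finset (Fin n)} (hS : S.card = k)
    {α B q : ℝ} (hB : 1 ≤ B) (hq : q ≤ 1 / 2) (hBq : Real.exp 1 ≤ q * √B)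
    (hα : ∀ t : ℝ, B * ((k : ℝ) ^ 2 / n) < t → t ≤ k →
      α * t ≤ 1 / 2 * Real.log (t / ((k : ℝ) ^ 2 / n))) :
    ∑ S' ∈ (Finset.powersetCard k (Finset.univ : Finset (Fin n))).filter
        fun S' => B * ((k : ℝ) ^ 2 / n) < ((S ∩ S').card : ℝ),
      Real.exp (α * ((S ∩ S').card : ℝ) ^ 2) ≤ n.choose k * (2 * q) := by
  have hkn : k ≤ n := by simpa [hS] using Finset.card_le_univ S
  have hn : (0 : ℝ) < n := by exact_mod_cast hk.trans_le hkn
  have hk' : (0 : ℝ) < k := by exact_mod_cast hk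
  set lam : ℝ := (k : ℝ) ^ 2 / n with hlam
  have hlam0 : 0 < lam := by positivity
  have hB0 : 0 < √B := Real.sqrt_pos.2 (by linarith)
  have hq0 : 0 < q := by
    by_contra h
    have := mul_nonpos_of_nonpos_of_nonneg (not_lt.1 h) hB0.le
    linarith [Real.exp_pos 1]
  set 𝒮 := Finset.powersetCard k (Finset.univ : Finset (Fin n))
  have hterm : ∀ t ∈ Finset.Icc 1 k,
      ∑ S' ∈ (𝒮.filter fun S' => B * lam < ((S ∩ S').card : ℝ)).filter
        (fun S' => (S ∩ S').card = t), Real.exp (α * ((S ∩ S').card : ℝ) ^ 2) ≤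
      n.choose k * q ^ t := by
    intro t ht
    obtain ⟨ht1, htk⟩ := Finset.mem_Icc.1 ht
    have ht0 : (0 : ℝ) < t := by exact_mod_cast ht1
    have htk' : (t : ℝ) ≤ k := by exact_mod_cast htk
    by_cases hBt : B * lam < t
    · have hlog := hα t hBt htk'
      have hc := card_overlap_ge_le hk hS (z := t / lam) (u := t) (by positivity) ht0.le
      rw [← hlam, div_mul_cancel₀ _ hlam0.ne'] at hc
      have hlogB : Real.log B ≤ Real.log (t / lam) :=
        Real.log_le_log (by linarith) ((le_div_iff₀ hlam0).2 hBt.le)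
      have hlogq : 1 ≤ Real.log q + 1 / 2 * Real.log B := by
        have := Real.log_le_log (Real.exp_pos 1) hBq
        rw [Real.log_exp, Real.log_mul hq0.ne' hB0.ne', Real.log_sqrt (by linarith)] at this
        linarith
      calc _ ≤ ∑ S' ∈ 𝒮.filter (fun S' => (t : ℝ) ≤ ((S ∩ S').card : ℝ)),
            Real.exp (α * (t : ℝ) ^ 2) := by
            refine le_trans (le_of_eq (Finset.sum_congr rfl fun S' hS' => ?_))
              (Finset.sum_le_sum_of_subset_of_nonneg (fun S' hS' => ?_)
                fun _ _ _ => (Real.exp_pos _).le)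
            · rw [(Finset.mem_filter.1 hS').2]
            · simp only [Finset.mem_filter] at hS' ⊢
              exact ⟨hS'.1.1, by rw [hS'.2]⟩
        _ ≤ (n.choose k * Real.exp (t - t * Real.log (t / lam))) * Real.exp (α * (t : ℝ) ^ 2) := by
            rw [Finset.sum_const, nsmul_eq_mul]
            gcongr
        _ = n.choose k * Real.exp (t - t * Real.log (t / lam) + α * (t : ℝ) ^ 2) := by
            rw [mul_assoc, ← Real.exp_add]
        _ ≤ n.choose k * Real.exp (t * Real.log q) := by
            gcongr
            nlinarith
        _ = _ := by rw [Real.exp_nat_mul, Real.exp_log hq0]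
    · rw [Finset.sum_eq_zero_iff_of_nonneg (fun _ _ => (Real.exp_pos _).le) |>.2]
      · positivity
      · intro S' hS'
        simp only [Finset.mem_filter] at hS'
        rw [hS'.2] at hS'
        exact absurd hS'.1.2 hBt
  rw [← Finset.sum_fiberwise_of_maps_to (t := Finset.Icc 1 k) (g := fun S' => (S ∩ S').card)]
  · refine (Finset.sum_le_sum hterm).trans ?_
    rw [← Finset.mul_sum]
    gcongr
    have h1 : ∑ t ∈ Finset.Icc 1 k, q ^ t = q * ∑ t ∈ Finset.range k, q ^ t := by
      rw [Finset.mul_sum, Finset.range_eq_Ico, ← Finset.Ico_add_one_right_eq_Icc,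
        Finset.sum_Ico_eq_sum_range]
      simp only [Nat.add_sub_cancel, Finset.range_eq_Ico, pow_add, pow_one]
    have h2 : ∑ t ∈ Finset.range k, q ^ t ≤ 2 := by
      have h3 : (∑ t ∈ Finset.range k, q ^ t) * (1 - q) = 1 - q ^ k := geom_sum_mul_neg q k
      have h4 : 0 ≤ q ^ k := by positivity
      have h5 : 0 ≤ ∑ t ∈ Finset.range k, q ^ t := Finset.sum_nonneg fun _ _ => by positivity
      nlinarith
    rw [h1]
    nlinarith
  · intro S' hS'
    simp only [Finset.mem_filter] at hS'
    rw [Finset.mem_Icc]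
    refine ⟨?_, hS ▸ Finset.card_le_card Finset.inter_subset_left⟩
    have : (0 : ℝ) < (S ∩ S').card := lt_of_le_of_lt (by positivity) hS'.2
    exact_mod_cast this

/-- The three smallness conditions on the clique size and the sample size. -/
structure SmallSample (η : ℝ) (n k m : ℕ) : Prop where
  card_le : (k : ℝ) ≤ η * n
  sample_le_log : (m : ℝ) ≤ η * (k * Real.log (n / k))
  sample_le_sq : (m : ℝ) ≤ η * ((n : ℝ) ^ 2 / (k : ℝ) ^ 2)

/-- In terms of `u = t / (k² / n)`, which lies between `e` and `n / k`, the left side is `C m u /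
n`. As `log x / x` decreases beyond `e`, the bound on `m` yields `C η log u`. -/
lemma linear_le_half_log {n k m C η B t : ℝ} (hk : 0 < k) (hn : 0 < n) (hC : 0 ≤ C)
    (hη0 : 0 ≤ η)
    (hη : 2 * (C * η) ≤ 1) (hm : m ≤ η * (k * Real.log (n / k)))
    (hB : Real.exp 1 ≤ B) (ht1 : B * (k ^ 2 / n) < t) (ht2 : t ≤ k) :
    C * m / k ^ 2 * t ≤ 1 / 2 * Real.log (t / (k ^ 2 / n)) := by
  have hlam0 : 0 < k ^ 2 / n := by positivity
  have hy0 : 0 < n / k := by positivity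
  have hylam : n / k * (k ^ 2 / n) = k := by field_simp
  have he1 : 1 ≤ Real.exp 1 := Real.one_le_exp (by norm_num)
  have hu1 : B ≤ t / (k ^ 2 / n) := (le_div_iff₀ hlam0).2 ht1.le
  have hu2 : t / (k ^ 2 / n) ≤ n / k := (div_le_iff₀ hlam0).2 (by rwa [hylam])
  have h3 : t = t / (k ^ 2 / n) * (k ^ 2 / n) := by field_simp
  set u := t / (k ^ 2 / n)
  have hu0 : 0 < u := by linarith
  have hlogu : 0 ≤ Real.log u := Real.log_nonneg (by linarith)
  have h1 : Real.log (n / k) / (n / k) ≤ Real.log u / u :=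
    Real.log_div_self_antitoneOn (show Real.exp 1 ≤ u by linarith)
      (show Real.exp 1 ≤ n / k by linarith) hu2
  have h4 : C * m ≤ C * η * Real.log u * (n / u) := by
    calc C * m ≤ C * (η * (k * Real.log (n / k))) := by gcongr
      _ = C * η * (Real.log (n / k) / (n / k)) * n := by field_simp
      _ ≤ C * η * (Real.log u / u) * n := by
          gcongr
      _ = _ := by field_simp
  calc C * m / k ^ 2 * t = C * m * u / n := by rw [h3]; field_simp
    _ ≤ C * η * Real.log u * (n / u) * u / n := by gcongr
    _ = C * η * Real.log u := by field_simp
    _ ≤ 1 / 2 * Real.log u := by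
        gcongr
        linarith

/-- The sample term uses at most half of the entropy `ρ k L`; the lower bound on `L` makes the other
half cover `k` and `log (3 / ε)`. -/
lemma exp_overlap_tail_le {ε D ρ η k m L : ℝ} (hε : 0 < ε) (hD : 0 ≤ D) (hρ : 0 < ρ) (hk : 1 ≤ k)
    (hη : 2 * (D * η) ≤ ρ) (hL : 2 / ρ * (1 + |Real.log (3 / ε)|) ≤ L) (hm : m ≤ η * (k * L)) :
    Real.exp (k - ρ * k * L + D * m) ≤ ε / 3 := by
  rw [← Real.le_log_iff_exp_le (by positivity)]
  have hL0 : 0 ≤ L := le_trans (by positivity) hL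
  have h1 : D * m ≤ ρ / 2 * (k * L) := by
    calc D * m ≤ D * (η * (k * L)) := by gcongr
      _ = (D * η) * (k * L) := by ring
      _ ≤ ρ / 2 * (k * L) := by
          gcongr
          linarith
  have h2 : 1 + |Real.log (3 / ε)| ≤ ρ / 2 * L := by
    have := mul_le_mul_of_nonneg_left hL (half_pos hρ).le
    rw [← mul_assoc] at this
    rwa [show ρ / 2 * (2 / ρ) = 1 by field_simp, one_mul] at this
  have h3 : Real.log (ε / 3) = -Real.log (3 / ε) := by
    rw [← Real.log_inv, inv_div]
  have h4 := le_abs_self (Real.log (3 / ε))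
  have h5 : k * (ρ / 2 * L - 1) ≥ 1 * (ρ / 2 * L - 1) := by
    have := abs_nonneg (Real.log (3 / ε))
    gcongr
    linarith
  rw [h3]
  linarith

/-- The second moment of the overlap is close to one when the sample is small. -/
theorem exists_overlap_sum_le {ε C D ρ : ℝ} (hε : 0 < ε) (hC : 0 ≤ C) (hD : 0 ≤ D) (hρ : 0 < ρ) :
    ∃ η > 0, ∀ (n k m : ℕ) (S : Finset (Fin n)), 0 < k → S.card = k → SmallSample η n k m →
      ∀ g : Finset (Fin n) → ℝ,
      (∀ S', S'.card = k → ((S ∩ S').card : ℝ) ≤ ρ * k →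
        g S' ≤ Real.exp (C * m * ((S ∩ S').card / k : ℝ) ^ 2)) →
      (∀ S', S'.card = k → g S' ≤ Real.exp (D * m)) →
      ∑ S' ∈ Finset.powersetCard k (Finset.univ : Finset (Fin n)), g S' ≤
        n.choose k * (1 + ε) := by
  set q : ℝ := min (1 / 2) (ε / 6) with hq
  have hq0 : 0 < q := lt_min (by norm_num) (by positivity)
  have hq1 : q ≤ 1 / 2 := min_le_left _ _
  have hq2 : q ≤ ε / 6 := min_le_right _ _
  set B : ℝ := (Real.exp 1 / q) ^ 2 with hB
  have hsqrtB : √B = Real.exp 1 / q := Real.sqrt_sq (by positivity)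
  have heq : Real.exp 1 ≤ Real.exp 1 / q := by
    rw [le_div_iff₀ hq0]
    nlinarith [Real.exp_pos 1]
  have he1 : 1 ≤ Real.exp 1 := Real.one_le_exp (by norm_num)
  have hBe : Real.exp 1 ≤ B := by rw [hB]; nlinarith
  have hB0 : 0 < B := by linarith
  set L₀ : ℝ := 2 / ρ * (1 + |Real.log (3 / ε)|) with hL₀
  -- One constraint for each need: typical overlaps, the logarithmic bound at intermediate overlaps,
  -- the exponent at large overlaps, and `log (n / k) ≥ L₀`.
  set η : ℝ := min (min (Real.log (1 + ε / 3) / (C * B ^ 2 + 1)) (1 / (2 * C + 1)))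
    (min (ρ / (2 * D + 1)) (Real.exp (-L₀))) with hη
  have hlogε : 0 < Real.log (1 + ε / 3) := Real.log_pos (by linarith)
  have hη0 : 0 < η := by
    refine lt_min (lt_min (by positivity) (by positivity)) (lt_min (by positivity) (by positivity))
  have hη1 : η ≤ Real.log (1 + ε / 3) / (C * B ^ 2 + 1) :=
    (min_le_left _ _).trans (min_le_left _ _)
  have hη2 : η ≤ 1 / (2 * C + 1) := (min_le_left _ _).trans (min_le_right _ _)
  have hη3 : η ≤ ρ / (2 * D + 1) := (min_le_right _ _).trans (min_le_left _ _)
  have hη4 : η ≤ Real.exp (-L₀) := (min_le_right _ _).trans (min_le_right _ _)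
  rw [le_div_iff₀ (by positivity)] at hη1 hη2 hη3
  refine ⟨η, hη0, fun n k m S hk hS hs g hg1 hg2 => ?_⟩
  have hkn : k ≤ n := by simpa [hS] using Finset.card_le_univ S
  have hn : (0 : ℝ) < n := by exact_mod_cast hk.trans_le hkn
  have hk' : (0 : ℝ) < k := by exact_mod_cast hk
  have hk1 : (1 : ℝ) ≤ k := by exact_mod_cast hk
  obtain ⟨hs1, hs2, hs3⟩ := hs
  set y : ℝ := (n : ℝ) / k with hy
  have hy0 : 0 < y := by positivity
  set L : ℝ := Real.log y with hL
  have hLL : L₀ ≤ L := by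
    rw [hL, Real.le_log_iff_exp_le hy0, hy, le_div_iff₀ hk']
    have h1 : (k : ℝ) ≤ Real.exp (-L₀) * n := hs1.trans (by gcongr)
    calc Real.exp L₀ * k ≤ Real.exp L₀ * (Real.exp (-L₀) * n) := by gcongr
      _ = n := by rw [← mul_assoc, ← Real.exp_add]; simp
  have hL0 : 0 ≤ L := le_trans (by positivity) hLL
  set lam : ℝ := (k : ℝ) ^ 2 / n with hlam
  have hlam0 : 0 < lam := by positivity
  have hylam : y * lam = k := by rw [hy, hlam]; field_simp
  set α : ℝ := C * m / (k : ℝ) ^ 2 with hα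
  have hα0 : 0 ≤ α := by positivity
  set 𝒮 := Finset.powersetCard k (Finset.univ : Finset (Fin n)) with h𝒮
  have hαlog : ∀ t : ℝ, B * lam < t → t ≤ k → α * t ≤ 1 / 2 * Real.log (t / lam) :=
    fun t ht1 ht2 => linear_le_half_log hk' hn hC hη0.le (by linarith) hs2 hBe ht1 ht2
  have hmid := sum_le_of_overlap_small hk hS (α := α) (q := q) (le_trans he1 hBe) hq1
    (by rw [hsqrtB, mul_div_cancel₀ _ hq0.ne']) hαlog
  have hfar := card_overlap_ge_le hk hS (z := y) (u := ρ * k) hy0 (by positivity)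
  rw [← hlam, hylam, ← hL] at hfar
  -- Three ranges of overlap: up to `B * lam`, where the weight is nearly one; above it, where the
  -- quadratic bound holds; and from `ρ * k` on, where only the cap `exp (D m)` is used. The last
  -- two may overlap, which is harmless.
  have hpoint : ∀ S' ∈ 𝒮, g S' ≤ (1 + ε / 3) +
      ((if B * lam < ((S ∩ S').card : ℝ) then Real.exp (α * ((S ∩ S').card : ℝ) ^ 2) else 0) +
      if ρ * k ≤ ((S ∩ S').card : ℝ) then Real.exp (D * m) else 0) := by
    intro S' hS'
    have hS'k := (Finset.mem_powersetCard.1 hS').2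
    have hαr : C * m * ((S ∩ S').card / k : ℝ) ^ 2 = α * ((S ∩ S').card : ℝ) ^ 2 := by
      rw [hα]; field_simp
    by_cases h1 : ρ * k ≤ ((S ∩ S').card : ℝ)
    · rw [if_pos h1]
      have : (0 : ℝ) ≤ if B * lam < ((S ∩ S').card : ℝ) then
          Real.exp (α * ((S ∩ S').card : ℝ) ^ 2) else 0 := by split_ifs <;> positivity
      linarith [hg2 S' hS'k]
    · rw [if_neg h1]
      have h2 := hg1 S' hS'k (not_le.1 h1).le
      rw [hαr] at h2
      split_ifs with h3
      · linarith
      · have h4 : α * ((S ∩ S').card : ℝ) ^ 2 ≤ Real.log (1 + ε / 3) := by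
          calc α * ((S ∩ S').card : ℝ) ^ 2 ≤ α * (B * lam) ^ 2 := by
                gcongr; exact not_lt.1 h3
            _ = C * B ^ 2 * (m * ((k : ℝ) ^ 2 / (n : ℝ) ^ 2)) := by
                rw [hα, hlam]; field_simp
            _ ≤ C * B ^ 2 * η := by
                gcongr
                calc (m : ℝ) * ((k : ℝ) ^ 2 / (n : ℝ) ^ 2)
                    ≤ η * ((n : ℝ) ^ 2 / (k : ℝ) ^ 2) * ((k : ℝ) ^ 2 / (n : ℝ) ^ 2) := by gcongr
                  _ = η := by field_simp
            _ ≤ _ := by nlinarith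
        have h5 := Real.exp_le_exp.2 h4
        rw [Real.exp_log (by linarith)] at h5
        linarith
  refine (Finset.sum_le_sum hpoint).trans ?_
  rw [Finset.sum_add_distrib, Finset.sum_const, Finset.sum_add_distrib, ← Finset.sum_filter,
    ← Finset.sum_filter, Finset.sum_const, nsmul_eq_mul, nsmul_eq_mul]
  have hcard : (𝒮.card : ℝ) = n.choose k := by
    rw [h𝒮, Finset.card_powersetCard, Finset.card_univ, Fintype.card_fin]
  rw [hcard]
  have hN0 : (0 : ℝ) ≤ n.choose k := Nat.cast_nonneg _
  have hfar2 : ((𝒮.filter fun S' => ρ * k ≤ ((S ∩ S').card : ℝ)).card : ℝ) * Real.exp (D * m) ≤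
      n.choose k * (ε / 3) := by
    calc _ ≤ (n.choose k * Real.exp (k - ρ * k * L)) * Real.exp (D * m) := by gcongr
      _ = n.choose k * Real.exp (k - ρ * k * L + D * m) := by rw [mul_assoc, ← Real.exp_add]
      _ ≤ _ := by
          gcongr
          exact exp_overlap_tail_le hε hD hρ hk1 (by linarith) hLL hs2
  have hmid2 : (n.choose k : ℝ) * (2 * q) ≤ n.choose k * (ε / 3) := by
    gcongr; linarith
  linarith

/-! ### Truncated second moment -/

lemma typeIIError_le_iSup (μ : Measure ℝ) (θ : ℝ) {n m k : ℕ} (φ : Test n m)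
    {S : Finset (Fin n)} (hS : S.card = k) :
    typeIIError μ θ S φ ≤ ⨆ S : {S : Finset (Fin n) // S.card = k}, typeIIError μ θ S.1 φ :=
  le_ciSup (f := fun S : {S : Finset (Fin n) // S.card = k} => typeIIError μ θ S.1 φ)
    (Set.finite_range _).bddAbove ⟨S, hS⟩

lemma sub_mul_le_of_sq {w f p ε : ℝ} (hw : 0 < w) (hp0 : 0 ≤ p) (hp1 : p ≤ 1) (hε : 0 < ε) :
    (w - f) * p ≤ ε / 2 * w + (w - f) ^ 2 / (2 * ε * w) := by
  have h1 : (w - f) * p ≤ |w - f| := by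
    calc (w - f) * p ≤ |w - f| * p := by gcongr; exact le_abs_self _
      _ ≤ |w - f| := mul_le_of_le_one_right (abs_nonneg _) hp1
  have h2 : ε / 2 * w + (w - f) ^ 2 / (2 * ε * w) - |w - f| =
      (ε * w - |w - f|) ^ 2 / (2 * ε * w) := by
    rw [← sq_abs (w - f)]
    field_simp
    ring
  have h3 : 0 ≤ (ε * w - |w - f|) ^ 2 / (2 * ε * w) := by positivity
  linarith

/-- The worst case dominates the average over cliques, and replacing the planted laws by minorants
only lowers the type II error. The relative variance of the mixture about the uniform law is at most
`2 * ε₁ + ε₂ ≤ ε ^ 2`, so the AM–GM bound `sub_mul_le_of_sq` loses at most `ε / 2 + ε / 2`. -/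
lemma risk_ge_of_second_moment {μ : Measure ℝ} [IsProbabilityMeasure μ]
    (hμ : μ.map (fun h : ℝ => -h) = μ) {θ : ℝ} {n m k : ℕ} (hkn : k ≤ n) (φ : Test n m)
    (T : Finset (Fin n) → (Fin m → Config n) → ℝ) {ε ε₁ ε₂ : ℝ} (hε : 0 < ε)
    (hεε : 2 * ε₁ + ε₂ ≤ ε ^ 2)
    (hT : ∀ S x, T S x ≤ ∏ j, plantedProb μ θ S (x j))
    (hmass : ∀ S : Finset (Fin n), S.card = k → 1 - ε₁ ≤ ∑ x, T S x)
    (hsec : ∀ S : Finset (Fin n), S.card = k →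
      ∑ S' ∈ Finset.powersetCard k (Finset.univ : Finset (Fin n)),
        ((2 : ℝ) ^ n) ^ m * ∑ x, T S x * T S' x ≤ n.choose k * (1 + ε₂)) :
    1 - ε ≤ risk μ θ k φ := by
  set 𝒮 := Finset.powersetCard k (Finset.univ : Finset (Fin n)) with h𝒮
  set N : ℝ := (n.choose k : ℝ) with hN
  have hcard : (𝒮.card : ℝ) = N := by
    rw [h𝒮, Finset.card_powersetCard, Finset.card_univ, Fintype.card_fin]
  have hN0 : 0 < N := by rw [hN]; exact_mod_cast Nat.choose_pos hkn
  have hmem : ∀ S ∈ 𝒮, S.card = k := fun S hS => (Finset.mem_powersetCard.1 hS).2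
  set W : ℝ := ((2 : ℝ) ^ n) ^ m with hW
  have hW0 : 0 < W := by positivity
  set f : (Fin m → Config n) → ℝ := fun x => N⁻¹ * ∑ S ∈ 𝒮, T S x with hf
  have hφ0 : ∀ x, 0 ≤ 1 - (φ x : ℝ) := fun x => sub_nonneg.2 (φ x).2.2
  have hφ1 : ∀ x, 1 - (φ x : ℝ) ≤ 1 := fun x => sub_le_self _ (φ x).2.1
  have htypeI : typeIError μ φ = ∑ x, W⁻¹ * (φ x : ℝ) := by
    unfold typeIError
    simp_rw [nullProb_eq hμ]
    simp [hW]
  have htypeII : ∑ x, f x * (1 - (φ x : ℝ)) ≤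
      ⨆ S : {S : Finset (Fin n) // S.card = k}, typeIIError μ θ S.1 φ := by
    set s := ⨆ S : {S : Finset (Fin n) // S.card = k}, typeIIError μ θ S.1 φ
    have h1 : ∑ x, f x * (1 - (φ x : ℝ)) = N⁻¹ * ∑ S ∈ 𝒮, ∑ x, T S x * (1 - (φ x : ℝ)) := by
      rw [Finset.sum_comm, Finset.mul_sum]
      refine Finset.sum_congr rfl fun x _ => ?_
      rw [hf, ← Finset.sum_mul]
      ring
    rw [h1, inv_mul_le_iff₀ hN0, ← hcard, ← nsmul_eq_mul]
    refine Finset.sum_le_card_nsmul _ _ _ fun S hS => ?_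
    refine le_trans ?_ (typeIIError_le_iSup μ θ φ (hmem S hS))
    exact Finset.sum_le_sum fun x _ => mul_le_mul_of_nonneg_right (hT S x) (hφ0 x)
  have hWsum : ∑ _x : Fin m → Config n, W⁻¹ = 1 := by
    rw [Finset.sum_const, Finset.card_univ, nsmul_eq_mul, Fintype.card_fun, card_config,
      Fintype.card_fin]
    push_cast
    exact mul_inv_cancel₀ hW0.ne'
  have hfmass : 1 - ε₁ ≤ ∑ x, f x := by
    rw [hf, ← Finset.mul_sum, Finset.sum_comm, le_inv_mul_iff₀ hN0, ← hcard, ← nsmul_eq_mul]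
    exact Finset.card_nsmul_le_sum _ _ _ fun S hS => hmass S (hmem S hS)
  have hfsec : W * ∑ x, f x ^ 2 ≤ 1 + ε₂ := by
    have h1 : W * ∑ x, f x ^ 2 =
        N⁻¹ * (N⁻¹ * ∑ S ∈ 𝒮, ∑ S' ∈ 𝒮, W * ∑ x, T S x * T S' x) := by
      have h2 : ∀ x, f x ^ 2 = N⁻¹ * (N⁻¹ * ∑ S ∈ 𝒮, ∑ S' ∈ 𝒮, T S x * T S' x) := fun x => by
        rw [hf, ← Finset.sum_mul_sum]; ring
      have h3 : ∑ x, ∑ S ∈ 𝒮, ∑ S' ∈ 𝒮, T S x * T S' x =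
          ∑ S ∈ 𝒮, ∑ S' ∈ 𝒮, ∑ x, T S x * T S' x :=
        Finset.sum_comm.trans (Finset.sum_congr rfl fun S _ => Finset.sum_comm)
      simp_rw [h2]
      rw [← Finset.mul_sum, ← Finset.mul_sum, h3]
      simp_rw [← Finset.mul_sum]
      ring
    rw [h1, inv_mul_le_iff₀ hN0, inv_mul_le_iff₀ hN0]
    refine (Finset.sum_le_card_nsmul _ _ _ fun S hS => hsec S (hmem S hS)).trans ?_
    rw [nsmul_eq_mul, hcard]
  clear_value f
  have hpoint : ∀ x, (W⁻¹ - f x) * (1 - (φ x : ℝ)) ≤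
      ε / 2 * W⁻¹ + 1 / (2 * ε) * (W⁻¹ - 2 * f x + W * f x ^ 2) := fun x => by
    refine (sub_mul_le_of_sq (inv_pos.2 hW0) (hφ0 x) (hφ1 x) hε).trans (le_of_eq ?_)
    field_simp
    ring
  have hsum := Finset.sum_le_sum fun x (_ : x ∈ Finset.univ) => hpoint x
  rw [Finset.sum_add_distrib, ← Finset.mul_sum, ← Finset.mul_sum, Finset.sum_add_distrib,
    Finset.sum_sub_distrib, ← Finset.mul_sum, ← Finset.mul_sum, hWsum] at hsum
  have hV : 1 / (2 * ε) * (1 - 2 * ∑ x, f x + W * ∑ x, f x ^ 2) ≤ ε / 2 := by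
    rw [one_div, inv_mul_le_iff₀ (by positivity)]
    nlinarith
  have hrisk : ∑ x, W⁻¹ * (φ x : ℝ) + ∑ x, f x * (1 - (φ x : ℝ)) +
      ∑ x, (W⁻¹ - f x) * (1 - (φ x : ℝ)) = 1 := by
    refine Eq.trans ?_ hWsum
    rw [← Finset.sum_add_distrib, ← Finset.sum_add_distrib]
    exact Finset.sum_congr rfl fun x _ => by ring
  unfold risk
  rw [htypeI]
  linarith

/-- The law of the sample under the clique `S`, restricted to samples whose total normalized
squared magnetization on `S` is at most `M` times the sample size. -/
noncomputable def truncProb (μ : Measure ℝ) (θ M : ℝ) {n m : ℕ} (S : Finset (Fin n))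
    (x : Fin m → Config n) : ℝ :=
  if ∑ j, mag S (x j) ^ 2 / (S.card : ℝ) ≤ M * m then ∏ j, plantedProb μ θ S (x j) else 0

section Trunc

variable {μ : Measure ℝ} {θ M : ℝ} {n m : ℕ}

lemma prod_plantedProb_nonneg (S : Finset (Fin n)) (x : Fin m → Config n) :
    0 ≤ ∏ j, plantedProb μ θ S (x j) :=
  Finset.prod_nonneg fun _ _ => plantedProb_nonneg μ θ S _

lemma truncProb_nonneg (S : Finset (Fin n)) (x : Fin m → Config n) :
    0 ≤ truncProb μ θ M S x := by
  unfold truncProb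
  split_ifs
  · exact prod_plantedProb_nonneg S x
  · exact le_rfl

lemma truncProb_le (S : Finset (Fin n)) (x : Fin m → Config n) :
    truncProb μ θ M S x ≤ ∏ j, plantedProb μ θ S (x j) := by
  unfold truncProb
  split_ifs
  · exact le_rfl
  · exact prod_plantedProb_nonneg S x

lemma sum_truncProb_mul_le_pow (S S' : Finset (Fin n)) :
    ((2 : ℝ) ^ n) ^ m * ∑ x : Fin m → Config n, truncProb μ θ M S x * truncProb μ θ M S' x ≤
      ((2 : ℝ) ^ n * ∑ σ, plantedProb μ θ S σ * plantedProb μ θ S' σ) ^ m := by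
  rw [mul_pow]
  gcongr
  rw [Fintype.sum_pow]
  refine Finset.sum_le_sum fun x _ => ?_
  rw [Finset.prod_mul_distrib]
  exact mul_le_mul (truncProb_le S x) (truncProb_le S' x) (truncProb_nonneg S' x)
    (prod_plantedProb_nonneg S x)

variable [IsProbabilityMeasure μ]

lemma sum_prod_plantedProb (S : Finset (Fin n)) :
    ∑ x : Fin m → Config n, ∏ j, plantedProb μ θ S (x j) = 1 := by
  rw [← Fintype.sum_pow, sum_plantedProb, one_pow]

/-- Exponential Markov over independent samples bounds the lost mass by the `m`-th power of `C * exp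
(-(c * M))`, hence by `ε` once `m ≥ 1`. For `m = 0` nothing is cut off. -/
lemma one_sub_le_sum_truncProb {c C ε : ℝ} (hc : 0 < c) {S : Finset (Fin n)}
    (hC : ∑ σ, plantedProb μ θ S σ * Real.exp (c * (mag S σ ^ 2 / S.card)) ≤ C)
    (hε0 : 0 ≤ ε) (hε : ε ≤ 1) (hM : C * Real.exp (-(c * M)) ≤ ε) :
    1 - ε ≤ ∑ x : Fin m → Config n, truncProb μ θ M S x := by
  rcases Nat.eq_zero_or_pos m with rfl | hm
  · simp [truncProb, hε0]
  have h1 : ∀ x : Fin m → Config n, ∏ j, plantedProb μ θ S (x j) - truncProb μ θ M S x ≤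
      ∏ j, (plantedProb μ θ S (x j) * Real.exp (c * (mag S (x j) ^ 2 / S.card)) *
        Real.exp (-(c * M))) := by
    intro x
    rw [Finset.prod_mul_distrib, Finset.prod_mul_distrib, ← Real.exp_sum, ← Real.exp_sum,
      mul_assoc, ← Real.exp_add]
    have h0 := prod_plantedProb_nonneg (μ := μ) (θ := θ) S x
    unfold truncProb
    split_ifs with h
    · rw [sub_self]; positivity
    · rw [sub_zero]
      refine le_mul_of_one_le_right h0 (Real.one_le_exp ?_)
      rw [← Finset.mul_sum, Finset.sum_const, Finset.card_univ, Fintype.card_fin, nsmul_eq_mul]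
      have := mul_le_mul_of_nonneg_left (not_le.1 h).le hc.le
      linarith
  have h2 := Finset.sum_le_sum fun x (_ : x ∈ Finset.univ) => h1 x
  rw [Finset.sum_sub_distrib, sum_prod_plantedProb, ← Fintype.sum_pow (fun σ =>
    plantedProb μ θ S σ * Real.exp (c * (mag S σ ^ 2 / S.card)) * Real.exp (-(c * M))),
    ← Finset.sum_mul] at h2
  have h3 : 0 ≤ ∑ σ, plantedProb μ θ S σ * Real.exp (c * (mag S σ ^ 2 / S.card)) :=
    Finset.sum_nonneg fun σ _ => mul_nonneg (plantedProb_nonneg μ θ S σ) (Real.exp_pos _).le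
  have h4 : (∑ σ, plantedProb μ θ S σ * Real.exp (c * (mag S σ ^ 2 / S.card))) *
      Real.exp (-(c * M)) ≤ ε := (mul_le_mul_of_nonneg_right hC (Real.exp_pos _).le).trans hM
  have h5 := pow_le_of_le_one (mul_nonneg h3 (Real.exp_pos (-(c * M))).le) (h4.trans hε) hm.ne'
  linarith

/-- On retained samples the likelihood ratio is at most `exp (θ / 2 * M * m)`, and the remaining
factor has total mass one. -/
lemma sum_truncProb_sq_le (hμ : μ.map (fun h : ℝ => -h) = μ) (hθ : 0 ≤ θ)
    (S : Finset (Fin n)) :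
    ((2 : ℝ) ^ n) ^ m * ∑ x : Fin m → Config n, truncProb μ θ M S x ^ 2 ≤
      Real.exp (θ / 2 * M * m) := by
  have hN : (0 : ℝ) < 2 ^ n := by positivity
  have h1 : ∀ x : Fin m → Config n, ((2 : ℝ) ^ n) ^ m * truncProb μ θ M S x ^ 2 ≤
      (∏ j, plantedProb μ θ S (x j)) * Real.exp (θ / 2 * M * m) := by
    intro x
    have h0 := prod_plantedProb_nonneg (μ := μ) (θ := θ) S x
    unfold truncProb
    split_ifs with h
    · rw [sq, mul_left_comm]
      refine mul_le_mul_of_nonneg_left ?_ h0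
      calc ((2 : ℝ) ^ n) ^ m * ∏ j, plantedProb μ θ S (x j)
          = ∏ j, ((2 : ℝ) ^ n * plantedProb μ θ S (x j)) := by
            rw [Finset.prod_mul_distrib]; simp
        _ ≤ ∏ j, Real.exp (θ / 2 * (mag S (x j) ^ 2 / S.card)) := by
            refine Finset.prod_le_prod
              (fun j _ => mul_nonneg hN.le (plantedProb_nonneg μ θ S _)) fun j _ => ?_
            have := mul_le_mul_of_nonneg_left (plantedProb_le hμ hθ S (x j)) hN.le
            rw [mul_inv_cancel_left₀ hN.ne'] at this
            refine this.trans (le_of_eq ?_)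
            congr 1
            ring
        _ = Real.exp (θ / 2 * ∑ j, mag S (x j) ^ 2 / (S.card : ℝ)) := by
            rw [← Real.exp_sum, Finset.mul_sum]
        _ ≤ _ := by
            rw [mul_assoc]
            gcongr
    · simp only [ne_eq, OfNat.ofNat_ne_zero, not_false_eq_true, zero_pow, mul_zero]
      positivity
  rw [Finset.mul_sum]
  refine (Finset.sum_le_sum fun x _ => h1 x).trans (le_of_eq ?_)
  rw [← Finset.sum_mul, sum_prod_plantedProb, one_mul]

lemma sum_truncProb_mul_le (hμ : μ.map (fun h : ℝ => -h) = μ) (hθ : 0 ≤ θ)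
    (S S' : Finset (Fin n)) :
    ((2 : ℝ) ^ n) ^ m * ∑ x : Fin m → Config n, truncProb μ θ M S x * truncProb μ θ M S' x ≤
      Real.exp (θ / 2 * M * m) := by
  have h1 : ∑ x : Fin m → Config n, truncProb μ θ M S x * truncProb μ θ M S' x ≤
      (∑ x : Fin m → Config n, truncProb μ θ M S x ^ 2 +
        ∑ x : Fin m → Config n, truncProb μ θ M S' x ^ 2) / 2 := by
    rw [← Finset.sum_add_distrib, Finset.sum_div]
    refine Finset.sum_le_sum fun x _ => ?_
    have := two_mul_le_add_sq (truncProb μ θ M S x) (truncProb μ θ M S' x)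
    linarith
  have h2 := mul_le_mul_of_nonneg_left h1 (by positivity : (0 : ℝ) ≤ ((2 : ℝ) ^ n) ^ m)
  have h3 := sum_truncProb_sq_le (M := M) (m := m) hμ hθ S
  have h4 := sum_truncProb_sq_le (M := M) (m := m) hμ hθ S'
  linarith

end Trunc

/-- At high temperature, every test has risk close to one when the sample is small. -/
theorem exists_risk_ge {μ : Measure ℝ} [IsProbabilityMeasure μ]
    (hμ : μ.map (fun h : ℝ => -h) = μ) {θ : ℝ} (hθ : HighTemperature μ θ) {ε : ℝ} (hε : 0 < ε) :
    ∃ η > 0, ∀ (n k m : ℕ), 0 < k → k ≤ n → SmallSample η n k m →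
      ∀ φ : Test n m, 1 - ε ≤ risk μ θ k φ := by
  obtain ⟨c, hc, C, hC⟩ := exists_exp_moment hμ hθ
  obtain ⟨ρ, hρ, K, hK, hover⟩ := exists_overlap_bound hμ hθ
  set ε₁ : ℝ := min 1 (ε ^ 2 / 4) with hε₁
  have hε₁0 : 0 < ε₁ := lt_min one_pos (by positivity)
  obtain ⟨M, hM0, hM⟩ : ∃ M : ℝ, 0 ≤ M ∧ C * Real.exp (-(c * M)) ≤ ε₁ := by
    have h1 : Tendsto (fun M : ℝ => C * Real.exp (-(c * M))) atTop (nhds (C * 0)) :=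
      (Real.tendsto_exp_neg_atTop_nhds_zero.comp (tendsto_id.const_mul_atTop hc)).const_mul C
    rw [mul_zero] at h1
    obtain ⟨M, h2, h3⟩ := ((eventually_ge_atTop 0).and (h1.eventually (gt_mem_nhds hε₁0))).exists
    exact ⟨M, h2, h3.le⟩
  have hθ0 := hθ.1
  obtain ⟨η, hη, hsum⟩ := exists_overlap_sum_le (ε := ε ^ 2 / 2) (C := K) (D := θ / 2 * M)
    (by positivity) hK (by positivity) hρ
  refine ⟨η, hη, fun n k m hk hkn hs φ => ?_⟩
  have hne : ∀ {S : Finset (Fin n)}, S.card = k → S.Nonempty := fun h =>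
    Finset.card_pos.1 (h ▸ hk)
  refine risk_ge_of_second_moment hμ hkn φ (truncProb μ θ M) hε (ε₁ := ε₁) (ε₂ := ε ^ 2 / 2)
    ?_ truncProb_le (fun S hS => one_sub_le_sum_truncProb hc (hC n S (hne hS)) hε₁0.le
      (min_le_left _ _) hM) fun S hS => ?_
  · have : ε₁ ≤ ε ^ 2 / 4 := min_le_right _ _
    linarith
  -- At small overlap the truncation is dropped so that the second moment factorizes over samples;
  -- the uniform cap from truncation serves all other pairs.
  · refine hsum n k m S hk hS hs _ (fun S' hS' hr => ?_)
      fun S' _ => sum_truncProb_mul_le hμ hθ0.le S S'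
    refine (sum_truncProb_mul_le_pow S S').trans ?_
    have h1 := hover n k S S' hk hS hS' hr
    have h2 : 0 ≤ (2 : ℝ) ^ n * ∑ σ, plantedProb μ θ S σ * plantedProb μ θ S' σ :=
      mul_nonneg (by positivity) (Finset.sum_nonneg fun σ _ =>
        mul_nonneg (plantedProb_nonneg μ θ S σ) (plantedProb_nonneg μ θ S' σ))
    have h3 := h1.trans ((add_comm _ _).le.trans (Real.add_one_le_exp _))
    refine (pow_le_pow_left₀ h2 h3 m).trans (le_of_eq ?_)
    rw [← Real.exp_nat_mul]
    congr 1
    ring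

lemma one_le_risk_of_no_sample (μ : Measure ℝ) (θ : ℝ) {n k : ℕ} (hkn : k ≤ n) (φ : Test n 0) :
    1 ≤ risk μ θ k φ := by
  obtain ⟨S, -, hS⟩ := Finset.exists_subset_card_eq
    (s := (Finset.univ : Finset (Fin n))) (n := k) (by simpa using hkn)
  have h := typeIIError_le_iSup μ θ φ hS
  have h2 : typeIError μ φ + typeIIError μ θ S φ = 1 := by
    simp [typeIError, typeIIError]
  unfold risk
  linarith

/-! ### Asymptotic regimes -/

/-- The alternative `m n = 0` is needed because an empty sample puts no constraint on `k n / n`, so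
`SmallSample` may fail. -/
lemma allTestsPowerless_of_smallSample {μ : Measure ℝ} [IsProbabilityMeasure μ]
    (hμ : μ.map (fun h : ℝ => -h) = μ) {θ : ℝ} (hθ : HighTemperature μ θ) {k m : ℕ → ℕ}
    (hk : ∀ᶠ n in atTop, 2 ≤ k n ∧ k n ≤ n)
    (hs : ∀ η : ℝ, 0 < η → ∀ᶠ n in atTop, m n = 0 ∨ SmallSample η n (k n) (m n)) :
    AllTestsPowerless μ θ k m := by
  intro φ ε hε
  obtain ⟨η, hη, H⟩ := exists_risk_ge hμ hθ hε
  filter_upwards [hk, hs η hη] with n hkn hsn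
  rcases hsn with h0 | hsn
  · have h1 : ∀ {m : ℕ}, m = 0 → ∀ φ : Test n m, 1 ≤ risk μ θ (k n) φ := by
      rintro m rfl φ
      exact one_le_risk_of_no_sample μ θ hkn.2 φ
    linarith [h1 h0 (φ n)]
  · exact H n (k n) (m n) (by omega) hkn.2 hsn (φ n)

lemma smallSample_of_isLittleO {k m : ℕ → ℕ} (hk : ∀ᶠ n in atTop, 2 ≤ k n ∧ k n ≤ n)
    (hk23 : (fun n => (k n : ℝ)) =o[atTop] (fun n : ℕ => (n : ℝ) ^ (2 / 3 : ℝ)))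
    (hm1 : (fun n => (m n : ℝ)) =o[atTop] (fun n : ℕ => (k n : ℝ) * Real.log n))
    (hm2 : (fun n => (m n : ℝ)) =o[atTop] (fun n : ℕ => (n : ℝ) ^ 2 / (k n : ℝ) ^ 2))
    {η : ℝ} (hη : 0 < η) : ∀ᶠ n in atTop, SmallSample η n (k n) (m n) := by
  filter_upwards [hk, hk23.bound (lt_min one_pos hη), hm1.bound (by positivity : 0 < η / 3),
    hm2.bound hη, eventually_ge_atTop 1] with n hkn h1 h2 h3 hn
  have hn1 : (1 : ℝ) ≤ n := by exact_mod_cast hn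
  have hn0 : (0 : ℝ) < n := by linarith
  have hk0 : (0 : ℝ) < k n := by exact_mod_cast (by omega : 0 < k n)
  have hlogn : 0 ≤ Real.log n := Real.log_nonneg hn1
  have hpow : (0 : ℝ) < (n : ℝ) ^ (2 / 3 : ℝ) := by positivity
  rw [Real.norm_of_nonneg (Nat.cast_nonneg _), Real.norm_of_nonneg hpow.le] at h1
  rw [Real.norm_of_nonneg (Nat.cast_nonneg _), Real.norm_of_nonneg (by positivity)] at h2
  rw [Real.norm_of_nonneg (Nat.cast_nonneg _), Real.norm_of_nonneg (by positivity)] at h3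
  have h4 : (k n : ℝ) ≤ (n : ℝ) ^ (2 / 3 : ℝ) := by
    refine h1.trans (mul_le_of_le_one_left hpow.le (min_le_left _ _))
  refine ⟨?_, ?_, h3⟩
  · refine h1.trans (mul_le_mul (min_le_right _ _) ?_ hpow.le hη.le)
    exact Real.rpow_le_self_of_one_le hn1 (by norm_num)
  -- Since `k ≤ n ^ (2 / 3)`, `log (n / k)` is at least a third of `log n`, which explains the bound
  -- `η / 3`.
  · have h5 : Real.log (k n) ≤ 2 / 3 * Real.log n := by
      rw [← Real.log_rpow hn0]
      exact Real.log_le_log hk0 h4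
    have h6 : 1 / 3 * Real.log n ≤ Real.log (n / k n) := by
      rw [Real.log_div hn0.ne' hk0.ne']; linarith
    calc (m n : ℝ) ≤ η / 3 * (k n * Real.log n) := h2
      _ = η * (k n * (1 / 3 * Real.log n)) := by ring
      _ ≤ _ := by gcongr

lemma half_le_log_two : (1 / 2 : ℝ) ≤ Real.log 2 := by
  have := Real.log_two_gt_d9
  linarith

/-- In the sparse regime the logarithmically corrected entropic bound dominates both others. -/
lemma isBigO_entropic {k : ℕ → ℕ} (hk : ∀ᶠ n in atTop, 2 ≤ k n ∧ k n ≤ n)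
    (hk23 : (fun n => (k n : ℝ)) =o[atTop] (fun n : ℕ => (n : ℝ) ^ (2 / 3 : ℝ))) :
    (fun n : ℕ => (k n : ℝ) / Real.log (k n) * Real.log n) =O[atTop]
        (fun n : ℕ => (k n : ℝ) * Real.log n) ∧
      (fun n : ℕ => (k n : ℝ) / Real.log (k n) * Real.log n) =O[atTop]
        (fun n : ℕ => (n : ℝ) ^ 2 / (k n : ℝ) ^ 2) := by
  have hlog : ∀ {j : ℕ}, 2 ≤ j → 1 / 2 ≤ Real.log j := fun {j} hj =>
    half_le_log_two.trans (Real.log_le_log (by norm_num) (by exact_mod_cast hj))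
  constructor
  · refine IsBigO.of_bound 2 ?_
    filter_upwards [hk, eventually_ge_atTop 1] with n hkn hn
    have h1 := hlog hkn.1
    have hlogn : 0 ≤ Real.log n := Real.log_nonneg (by exact_mod_cast hn)
    rw [Real.norm_of_nonneg (by positivity), Real.norm_of_nonneg (by positivity), ← mul_assoc]
    refine mul_le_mul_of_nonneg_right ?_ hlogn
    rw [div_le_iff₀ (by linarith)]
    have : (0 : ℝ) ≤ k n := Nat.cast_nonneg _
    nlinarith
  · refine IsBigO.of_bound 4 ?_
    filter_upwards [hk, hk23.bound one_pos, eventually_ge_atTop 1] with n hkn h2 hn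
    have h1 := hlog hkn.1
    have hn1 : (1 : ℝ) ≤ n := by exact_mod_cast hn
    have hn0 : (0 : ℝ) < n := by linarith
    have hk0 : (0 : ℝ) < k n := by exact_mod_cast (by omega : 0 < k n)
    have hlogn : 0 ≤ Real.log n := Real.log_nonneg hn1
    rw [one_mul, Real.norm_of_nonneg hk0.le, Real.norm_of_nonneg (by positivity)] at h2
    rw [Real.norm_of_nonneg (by positivity), Real.norm_of_nonneg (by positivity)]
    have h3 : (k n : ℝ) ^ 3 ≤ (n : ℝ) ^ 2 := by
      refine (pow_le_pow_left₀ hk0.le h2 3).trans (le_of_eq ?_)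
      rw [← Real.rpow_natCast, ← Real.rpow_mul hn0.le, ← Real.rpow_natCast]
      norm_num
    have key : (k n : ℝ) ^ 3 * Real.log n ≤ 4 * (n : ℝ) ^ 2 * Real.log (k n) := by
      -- For `k² ≤ n`, the crude `log n ≤ 2 √n` suffices, as `k³ ≤ n ^ (3 / 2)`. Otherwise `log n ≤
      -- 2 log k` and `k³ ≤ n²`.
      rcases le_total ((k n : ℝ) ^ 2) n with h4 | h4
      · set s := √(n : ℝ) with hs
        have hs0 : 0 < s := Real.sqrt_pos.2 hn0
        have hs2 : s ^ 2 = n := Real.sq_sqrt hn0.le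
        have hks : (k n : ℝ) ≤ s := Real.le_sqrt_of_sq_le h4
        have h5 : Real.log n ≤ 2 * s := by
          rw [← hs2, Real.log_pow]
          have := Real.log_le_self hs0.le
          push_cast
          linarith
        calc (k n : ℝ) ^ 3 * Real.log n ≤ s ^ 3 * (2 * s) := by gcongr
          _ = 4 * (n : ℝ) ^ 2 * (1 / 2) := by rw [← hs2]; ring
          _ ≤ _ := by gcongr
      · have h5 : Real.log n ≤ 2 * Real.log (k n) := by
          have := Real.log_le_log hn0 h4
          rw [Real.log_pow] at this
          exact_mod_cast this
        calc (k n : ℝ) ^ 3 * Real.log n ≤ (n : ℝ) ^ 2 * (2 * Real.log (k n)) := by gcongr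
          _ ≤ _ := by nlinarith [sq_nonneg (n : ℝ)]
    have hlk : 0 < Real.log (k n) := by linarith
    rw [div_mul_eq_mul_div, div_le_iff₀ hlk, ← mul_div_assoc, div_mul_eq_mul_div,
      le_div_iff₀ (by positivity)]
    calc (k n : ℝ) * Real.log n * (k n : ℝ) ^ 2 = (k n : ℝ) ^ 3 * Real.log n := by ring
      _ ≤ _ := key

/-- A nonempty sample forces `n² / k²` to be large, hence `k ≤ δ n` and `log (n / k) ≥ 1`. Since `n²
≤ K³ k³`, the bound `n² / k²` is itself at most `K³ k`, so the entropic condition follows from the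
quadratic one. -/
lemma smallSample_of_isBigO {k m : ℕ → ℕ} (hk : ∀ᶠ n in atTop, 2 ≤ k n ∧ k n ≤ n)
    (hk23 : (fun n : ℕ => (n : ℝ) ^ (2 / 3 : ℝ)) =O[atTop] (fun n => (k n : ℝ)))
    (hm : (fun n => (m n : ℝ)) =o[atTop] (fun n : ℕ => (n : ℝ) ^ 2 / (k n : ℝ) ^ 2))
    {η : ℝ} (hη : 0 < η) : ∀ᶠ n in atTop, m n = 0 ∨ SmallSample η n (k n) (m n) := by
  obtain ⟨K, hK, hKb⟩ := hk23.exists_pos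
  set δ : ℝ := min η (Real.exp (-1)) with hδ
  have hδ0 : 0 < δ := lt_min hη (Real.exp_pos _)
  have hδη : δ ≤ η := min_le_left _ _
  set η' : ℝ := min (δ ^ 2) (min η (η / K ^ 3)) with hη'
  have hη'0 : 0 < η' := lt_min (by positivity) (lt_min hη (by positivity))
  filter_upwards [hk, hKb.bound, hm.bound hη'0, eventually_ge_atTop 1] with n hkn h1 h2 hn
  rcases Nat.eq_zero_or_pos (m n) with hm0 | hm0
  · exact Or.inl hm0
  right
  have hn1 : (1 : ℝ) ≤ n := by exact_mod_cast hn
  have hn0 : (0 : ℝ) < n := by linarith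
  have hm1 : (1 : ℝ) ≤ m n := by exact_mod_cast hm0
  have hk0 : (0 : ℝ) < k n := by exact_mod_cast (by omega : 0 < k n)
  rw [Real.norm_of_nonneg (by positivity), Real.norm_of_nonneg hk0.le] at h1
  rw [Real.norm_of_nonneg (Nat.cast_nonneg _), Real.norm_of_nonneg (by positivity)] at h2
  have hX : (0 : ℝ) ≤ (n : ℝ) ^ 2 / (k n : ℝ) ^ 2 := by positivity
  have hkδ : (k n : ℝ) ≤ δ * n := by
    have h3 : (1 : ℝ) ≤ δ ^ 2 * ((n : ℝ) ^ 2 / (k n : ℝ) ^ 2) :=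
      hm1.trans (h2.trans (mul_le_mul_of_nonneg_right (min_le_left _ _) hX))
    rw [← mul_div_assoc, one_le_div (by positivity), ← mul_pow] at h3
    exact le_of_sq_le_sq h3 (by positivity)
  have hn23 : (n : ℝ) ^ 2 ≤ K ^ 3 * (k n : ℝ) ^ 3 := by
    have h3 := pow_le_pow_left₀ (by positivity) h1 3
    rw [← Real.rpow_natCast, ← Real.rpow_mul hn0.le, mul_pow] at h3
    norm_num at h3
    exact h3
  have hlog : 1 ≤ Real.log (n / k n) := by
    rw [Real.le_log_iff_exp_le (by positivity), le_div_iff₀ hk0]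
    have h3 : (k n : ℝ) ≤ Real.exp (-1) * n := hkδ.trans (by gcongr; exact min_le_right _ _)
    calc Real.exp 1 * k n ≤ Real.exp 1 * (Real.exp (-1) * n) := by gcongr
      _ = n := by rw [← mul_assoc, ← Real.exp_add]; simp
  refine ⟨hkδ.trans (by gcongr), ?_, h2.trans (mul_le_mul_of_nonneg_right
    ((min_le_right _ _).trans (min_le_left _ _)) hX)⟩
  calc (m n : ℝ) ≤ η / K ^ 3 * ((n : ℝ) ^ 2 / (k n : ℝ) ^ 2) :=
        h2.trans (mul_le_mul_of_nonneg_right ((min_le_right _ _).trans (min_le_right _ _)) hX)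
    _ ≤ η / K ^ 3 * (K ^ 3 * (k n : ℝ) ^ 3 / (k n : ℝ) ^ 2) := by gcongr
    _ = η * (k n * 1) := by field_simp
    _ ≤ _ := by gcongr

end PlantedRFCW

theorem mainTheorem2 (μ : Measure ℝ) [IsProbabilityMeasure μ]
    (hμ : μ.map (fun h : ℝ => -h) = μ) (θ : ℝ) (hθ : PlantedRFCW.HighTemperature μ θ)
    (k m : ℕ → ℕ) (hk : ∀ᶠ n in atTop, 2 ≤ k n ∧ k n ≤ n) :
    ((fun n => (k n : ℝ)) =o[atTop] (fun n : ℕ => (n : ℝ) ^ (2 / 3 : ℝ)) →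
      (θ < 1 / (2 * PlantedRFCW.meanSechSq μ) →
        (fun n => (m n : ℝ)) =o[atTop] (fun n : ℕ => (k n : ℝ) * Real.log n) →
        (fun n => (m n : ℝ)) =o[atTop] (fun n : ℕ => (n : ℝ) ^ 2 / (k n : ℝ) ^ 2) →
        PlantedRFCW.AllTestsPowerless μ θ k m) ∧
      (1 / (2 * PlantedRFCW.meanSechSq μ) ≤ θ →
        (fun n => (m n : ℝ)) =o[atTop]
          (fun n : ℕ => (k n : ℝ) / Real.log (k n) * Real.log n) →
        PlantedRFCW.AllTestsPowerless μ θ k m)) ∧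
    ((fun n : ℕ => (n : ℝ) ^ (2 / 3 : ℝ)) =O[atTop] (fun n => (k n : ℝ)) →
      (fun n => (m n : ℝ)) =o[atTop] (fun n : ℕ => (n : ℝ) ^ 2 / (k n : ℝ) ^ 2) →
      PlantedRFCW.AllTestsPowerless μ θ k m) := by
  refine ⟨fun hk23 => ⟨fun _ hm1 hm2 => ?_, fun _ hm => ?_⟩, fun hk23 hm => ?_⟩
  · exact PlantedRFCW.allTestsPowerless_of_smallSample hμ hθ hk fun η hη =>
      (PlantedRFCW.smallSample_of_isLittleO hk hk23 hm1 hm2 hη).mono fun _ => Or.inr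
  · obtain ⟨h1, h2⟩ := PlantedRFCW.isBigO_entropic hk hk23
    exact PlantedRFCW.allTestsPowerless_of_smallSample hμ hθ hk fun η hη =>
      (PlantedRFCW.smallSample_of_isLittleO hk hk23 (hm.trans_isBigO h1) (hm.trans_isBigO h2)
        hη).mono fun _ => Or.inr
  · exact PlantedRFCW.allTestsPowerless_of_smallSample hμ hθ hk fun η hη =>
      PlantedRFCW.smallSample_of_isBigO hk hk23 hm hη
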